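/- For a real potential $q\in L^2[0,1]$ let $L_q=-\frac{d^2}{dx^2}+q$ act in $L^2[0,1]$ with Dirichlet boundary conditions at $0$ and $1$ (domain: $\phi\in H^2[0,1]$ with $\phi(0)=\phi(1)=0$). Let $\lambda_1(q)<\lambda_2(q)<\cdots$ be its eigenvalues, and let $\phi_{j,q}$ be the eigenfunction for $\lambda_j(q)$ normalized by $\int_0^1\phi_{j,q}^2\,dx=1$ and $\phi_{j,q}'(0)>0$. The heat content of $L_q$ is $$Q_q(t)=\sum_{j=1}^\infty e^{-t\lambda_j(q)}\Big(\int_0^1\phi_{j,q}(x)\,dx\Big)^2,\qquad t>0.$$ For $n\ge 1$ let $X_n(q)=2\frac{d}{dx}(\phi_{n,q})^2$, a vector field on $L^2[0,1]$. Let $n\ge 1$. The initial value problem $\frac{d}{ds}\gamma(s)=X_n(\gamma(s))$, $\gamma(0)=0$, has a solution $\gamma:\mathbb R\to L^2[0,1]$ (differentiable in the $L^2$ norm). For every such solution $\gamma_n$ and every $t>0$, the series defining $Q_{\gamma_n(s)}(t)$ converges for all $s$ near $0$, the function $s\mapsto Q_{\gamma_n(s)}(t)$ is differentiable at $s=0$,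 and $$\partial_s\big|_{s=0}\,Q_{\gamma_n(s)}(t)=0.$$ Moreover $X_n(0)\neq 0$, and for every $t>0$, if $d_0Q(t)$ is a Fréchet derivative at $q=0$ of the map $q\mapsto Q_q(t)$ from $L^2[0,1]$ to $\mathbb R$, then $d_0Q(t)$ annihilates $X_n(0)$; in this sense the differential of $q\mapsto Q_q(t)$ at $q=0$ has nontrivial kernel. -/

import Mathlib

open MeasureTheory Set Filter Topology

noncomputable section

/-- Lebesgue measure on `[0, 1]`. -/
abbrev unitMeasure : Measure ℝ := volume.restrict (Icc (0 : ℝ) 1)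

/-- The real Hilbert space `L²[0, 1]`. -/
abbrev UnitL2 : Type := Lp ℝ 2 unitMeasure

/-- `φ ∈ H²[0, 1]` with first derivative `φ₁` and second (weak) derivative `φ₂ ∈ L²[0, 1]`:
on `[0, 1]`, `φ` is a primitive of `φ₁` and `φ₁` is a primitive of `φ₂`. In particular `φ` is
`C¹` on `[0, 1]` (the continuous representative is used); values off `[0, 1]` play no role. -/
structure IsH2 (φ φ₁ φ₂ : ℝ → ℝ) : Prop where
  memLp : MemLp φ₂ 2 unitMeasure
  eq_one : ∀ x ∈ Icc (0 : ℝ) 1, φ₁ x = φ₁ 0 + ∫ r in (0 : ℝ)..x, φ₂ r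
  eq_zero : ∀ x ∈ Icc (0 : ℝ) 1, φ x = φ 0 + ∫ r in (0 : ℝ)..x, φ₁ r

/-- `φ`, with derivative `φ₁`, lies in the domain of the Dirichlet operator
`L_q = -d²/dx² + q` and satisfies `L_q φ = lam φ` (possibly `φ = 0`). -/
def IsDirichletSolution (q : UnitL2) (lam : ℝ) (φ φ₁ : ℝ → ℝ) : Prop :=
  ∃ φ₂ : ℝ → ℝ, IsH2 φ φ₁ φ₂ ∧ φ 0 = 0 ∧ φ 1 = 0 ∧
    ∀ᵐ x ∂unitMeasure, -φ₂ x + q x * φ x = lam * φ x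

/-- `lam` is an eigenvalue of `L_q`. -/
def IsDirichletEigenvalue (q : UnitL2) (lam : ℝ) : Prop :=
  ∃ φ φ₁ : ℝ → ℝ, IsDirichletSolution q lam φ φ₁ ∧ ∃ x ∈ Icc (0 : ℝ) 1, φ x ≠ 0

/-- `φ` is an eigenfunction of `L_q` for `lam`, normalized by `∫₀¹ φ² = 1` and `φ'(0) > 0`. -/
def IsNormalizedEigenfunction (q : UnitL2) (lam : ℝ) (φ : ℝ → ℝ) : Prop :=
  ∃ φ₁ : ℝ → ℝ, IsDirichletSolution q lam φ φ₁ ∧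
    (∫ x in (0 : ℝ)..1, φ x ^ 2) = 1 ∧ 0 < φ₁ 0

/-- `λ_j(q)`, `j ≥ 1`: the `j`-th eigenvalue of `L_q` in increasing order, that is, the
eigenvalue with exactly `j - 1` eigenvalues below it (the set has one element). -/
def dirichletEigenvalue (q : UnitL2) (j : ℕ) : ℝ :=
  sInf {lam : ℝ | IsDirichletEigenvalue q lam ∧
    {μ : ℝ | IsDirichletEigenvalue q μ ∧ μ < lam}.encard + 1 = (j : ℕ∞)}

open Classical in
/-- `φ_{j,q}`, `j ≥ 1`: the normalized eigenfunction for `λ_j(q)` (unique on `[0, 1]`). -/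
def dirichletEigenfunction (q : UnitL2) (j : ℕ) : ℝ → ℝ :=
  if h : ∃ φ, IsNormalizedEigenfunction q (dirichletEigenvalue q j) φ then h.choose else 0

/-- The `j`-th term `e^{-t λ_j(q)} (∫₀¹ φ_{j,q})²` of the heat content. -/
def heatContentTerm (q : UnitL2) (t : ℝ) (j : ℕ) : ℝ :=
  Real.exp (-t * dirichletEigenvalue q j) *
    (∫ x in (0 : ℝ)..1, dirichletEigenfunction q j x) ^ 2

/-- The heat content `Q_q(t)`, the sum over `j = 1, 2, 3, …`. -/
def heatContent (q : UnitL2) (t : ℝ) : ℝ :=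
  ∑' j : ℕ, heatContentTerm q t (j + 1)

/-- The function `2 d/dx (φ_{n,q})²` on `[0, 1]`. -/
def vectorFieldFun (n : ℕ) (q : UnitL2) (x : ℝ) : ℝ :=
  2 * deriv (fun y => dirichletEigenfunction q n y ^ 2) x

theorem IsH2.memLp_deriv_sq {φ φ₁ φ₂ : ℝ → ℝ} (h : IsH2 φ φ₁ φ₂) :
    MemLp (fun x => 2 * deriv (fun y => φ y ^ 2) x) 2 unitMeasure := by
  have hint : IntegrableOn φ₂ (Icc (0 : ℝ) 1) := h.memLp.integrable (by norm_num)
  have hc1 : ContinuousOn φ₁ (Icc (0 : ℝ) 1) := by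
    have := intervalIntegral.continuousOn_primitive_interval (μ := volume) (f := φ₂)
      (a := 0) (b := 1) (by simpa [uIcc_of_le] using hint)
    rw [uIcc_of_le zero_le_one] at this
    exact (continuousOn_const.add this).congr h.eq_one
  have hint1 : IntegrableOn φ₁ (Icc (0 : ℝ) 1) := hc1.integrableOn_Icc
  have hc0 : ContinuousOn φ (Icc (0 : ℝ) 1) := by
    have := intervalIntegral.continuousOn_primitive_interval (μ := volume) (f := φ₁)
      (a := 0) (b := 1) (by simpa [uIcc_of_le] using hint1)
    rw [uIcc_of_le zero_le_one] at this
    exact (continuousOn_const.add this).congr h.eq_zero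
  have hd : ∀ x ∈ Ioo (0 : ℝ) 1, HasDerivAt φ (φ₁ x) x := by
    intro x hx
    have hnhds : Icc (0 : ℝ) 1 ∈ 𝓝 x := Icc_mem_nhds hx.1 hx.2
    have hii : IntervalIntegrable φ₁ volume 0 x :=
      (intervalIntegrable_iff_integrableOn_Icc_of_le hx.1.le).2
        (hint1.mono_set (Icc_subset_Icc_right hx.2.le))
    have hm : StronglyMeasurableAtFilter φ₁ (𝓝 x) volume :=
      ⟨Icc (0 : ℝ) 1, hnhds, hint1.aestronglyMeasurable⟩
    have h1 := (intervalIntegral.integral_hasDerivAt_right hii hm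
      (hc1.continuousAt hnhds)).const_add (φ 0)
    refine h1.congr_of_eventuallyEq ?_
    filter_upwards [hnhds] with y hy using h.eq_zero y hy
  have hcont : ContinuousOn (fun x => 4 * φ x * φ₁ x) (Icc (0 : ℝ) 1) :=
    (continuousOn_const.mul hc0).mul hc1
  obtain ⟨C, hC⟩ := isCompact_Icc.exists_bound_of_continuousOn hcont
  have hmem : MemLp (fun x => 4 * φ x * φ₁ x) 2 unitMeasure := by
    refine MemLp.of_bound (hcont.aestronglyMeasurable measurableSet_Icc) C ?_
    exact (ae_restrict_iff' measurableSet_Icc).2 (Eventually.of_forall hC)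
  refine hmem.ae_eq ?_
  rw [unitMeasure, ← restrict_Ioo_eq_restrict_Icc]
  refine (ae_restrict_iff' measurableSet_Ioo).2 (Eventually.of_forall fun x hx => ?_)
  have h1 : HasDerivAt (fun y => φ y ^ 2) _ x := (hd x hx).pow 2
  have h2 : deriv (fun y => φ y ^ 2) x = 2 * φ x * φ₁ x := by
    simpa using h1.deriv
  simp only [h2]
  ring

theorem memLp_vectorFieldFun (n : ℕ) (q : UnitL2) :
    MemLp (vectorFieldFun n q) 2 unitMeasure := by
  unfold vectorFieldFun dirichletEigenfunction
  split_ifs with h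
  · obtain ⟨φ₁, ⟨φ₂, h2, -⟩, -⟩ := h.choose_spec
    exact h2.memLp_deriv_sq
  · simp

/-- The vector field `X_n(q) = 2 d/dx (φ_{n,q})²` on `L²[0, 1]`. -/
def vectorField (n : ℕ) (q : UnitL2) : UnitL2 :=
  (memLp_vectorFieldFun n q).toLp (vectorFieldFun n q)

/-- `γ` solves `dγ/ds = X_n(γ)`, `γ(0) = 0`, as a curve in `L²[0, 1]` defined for all real `s`. -/
def IsFlowLine (n : ℕ) (γ : ℝ → UnitL2) : Prop :=
  γ 0 = 0 ∧ ∀ s : ℝ, HasDerivAt γ (vectorField n (γ s)) s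

end

/-! The flow of `X_n` through the zero potential is explicit. With g = √2 sin(nπx), κ = e^{-s} - 1
and τ = 1 + κ∫₀ˣ g², it is γ(s) = -2(log τ)''. The double commutation transform y ↦ y - κ (g/τ) ∫₀ˣ
g y turns solutions of -y'' = λy with y(0) = 0 into solutions for this potential with the same λ,
the same slope at 0 and the same value at 1. Hence all Dirichlet eigenvalues stay at (jπ)²
(`isDirichletEigenvalue_darbouxPotential`), and eigenfunctions and their norms are known in closed
form (`integral_darbouxSol_sq`).

Write g_j for the j-th sine mode, α = ∫ g_j, β = ∫ g(x) ∫₀ˣ g g_j dx and b = δ_{jn}. The squared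
mean of the normalized j-th eigenfunction is (1 + κb)(α - κβ + O(κ²))², with linear coefficient bα²
- 2αβ. Reflection about 1/2 makes this coefficient vanish for every j
(`two_mul_integral_mul_integral_overlap`). The quadratic remainder is bounded uniformly in j, so
summing against e^{-t(jπ)²} gives Q_{γ(s)}(t) - Q_0(t) = O(κ²), and the derivative at s = 0 is zero.

The statement concerns every flow line, so local uniqueness is also needed: `vectorField n` is
Lipschitz near 0 (`exists_lipschitzOnWith_vectorField`). This rests on Gronwall estimates for y'' =
Vy with V only integrable, on continuity at 0 of the n-th eigenvalue, and on the Wronskian identity,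
which bounds eigenvalue differences by the L² distance of the potentials. The claim on the Fréchet
derivative is the chain rule along the explicit flow. -/

noncomputable section

/-! ### The initial value problem `y'' = V y`, `y(0) = 0`, `y'(0) = c` with integrable `V` -/

/-- On `[0, 1]`, `y` (with derivative `y₁`) solves `y'' = V y`, `y 0 = 0`, `y' 0 = c`. -/
structure IsIVPSolution (V : ℝ → ℝ) (c : ℝ) (y y₁ : ℝ → ℝ) : Prop where
  continuousOn : ContinuousOn y (Icc (0 : ℝ) 1)
  deriv_eq : ∀ x ∈ Icc (0 : ℝ) 1, y₁ x = c + ∫ r in (0 : ℝ)..x, V r * y r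
  eq : ∀ x ∈ Icc (0 : ℝ) 1, y x = ∫ r in (0 : ℝ)..x, y₁ r

theorem intervalIntegrable_of_mem_Icc {f : ℝ → ℝ} (hf : IntegrableOn f (Icc (0 : ℝ) 1)) {x : ℝ}
    (hx : x ∈ Icc (0 : ℝ) 1) : IntervalIntegrable f volume 0 x :=
  (intervalIntegrable_iff_integrableOn_Icc_of_le hx.1).2
    (hf.mono_set (Icc_subset_Icc_right hx.2))

theorem integrableOn_mul_of_continuousOn {V y : ℝ → ℝ} (hV : IntegrableOn V (Icc (0 : ℝ) 1))
    (hy : ContinuousOn y (Icc (0 : ℝ) 1)) :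
    IntegrableOn (fun r => V r * y r) (Icc (0 : ℝ) 1) :=
  hV.mul_continuousOn hy isCompact_Icc

theorem continuousOn_primitive_unit {f : ℝ → ℝ} (hf : IntegrableOn f (Icc (0 : ℝ) 1)) :
    ContinuousOn (fun x => ∫ r in (0 : ℝ)..x, f r) (Icc (0 : ℝ) 1) := by
  have := intervalIntegral.continuousOn_primitive_interval (μ := volume) (f := f)
    (a := 0) (b := 1) (by simpa [uIcc_of_le] using hf)
  rwa [uIcc_of_le zero_le_one] at this

theorem abs_integral_mul_le_of_abs_le {V w : ℝ → ℝ} {B R x : ℝ}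
    (hV : IntegrableOn V (Icc (0 : ℝ) 1)) (hR : ∫ r in (0 : ℝ)..1, |V r| ≤ R) (hB : 0 ≤ B)
    (hx : x ∈ Icc (0 : ℝ) 1) (hw : ∀ r ∈ Icc (0 : ℝ) x, |w r| ≤ B) :
    |∫ r in (0 : ℝ)..x, V r * w r| ≤ R * B := by
  have hVx := intervalIntegrable_of_mem_Icc hV hx
  have hV1 := intervalIntegrable_of_mem_Icc hV (right_mem_Icc.2 zero_le_one)
  have h1 : ‖∫ r in (0 : ℝ)..x, V r * w r‖ ≤ ∫ r in (0 : ℝ)..x, |V r| * B := by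
    refine intervalIntegral.norm_integral_le_of_norm_le hx.1 ?_ (hVx.abs.mul_const B)
    refine Eventually.of_forall fun r hr => ?_
    rw [Real.norm_eq_abs, abs_mul]
    exact mul_le_mul_of_nonneg_left (hw r ⟨hr.1.le, hr.2⟩) (abs_nonneg _)
  have h2 : ∫ r in (0 : ℝ)..x, |V r| ≤ ∫ r in (0 : ℝ)..1, |V r| :=
    intervalIntegral.integral_mono_interval le_rfl hx.1 hx.2
      (Eventually.of_forall fun r => abs_nonneg _) hV1.abs
  rw [intervalIntegral.integral_mul_const] at h1
  exact h1.trans (mul_le_mul_of_nonneg_right (h2.trans hR) hB)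

theorem integral_exp_mul_le {M x : ℝ} (hM : 0 < M) :
    ∫ r in (0 : ℝ)..x, Real.exp (M * r) ≤ Real.exp (M * x) / M := by
  have h : ∀ r ∈ uIcc 0 x, HasDerivAt (fun r => Real.exp (M * r) / M) (Real.exp (M * r)) r := by
    intro r _
    have h1 : HasDerivAt (fun r => M * r) M r := by simpa using (hasDerivAt_id r).const_mul M
    have h2 := h1.exp.div_const M
    rwa [mul_div_cancel_right₀ _ hM.ne'] at h2
  rw [intervalIntegral.integral_eq_sub_of_hasDerivAt h
    ((by fun_prop : Continuous fun r => Real.exp (M * r)).intervalIntegrable _ _)]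
  have : 0 < Real.exp (M * 0) / M := by positivity
  linarith

/-- In the sup norm weighted by exp(-(2R + 1)x), integration gains the factor R/(2R + 1) ≤ 1/2. This
one gain drives both the Gronwall estimate and the contraction that proves existence. -/
theorem abs_integral_le_of_abs_le_add_exp {f : ℝ → ℝ} {ε R m x : ℝ} (hε : 0 ≤ ε) (hR : 0 ≤ R)
    (hm : 0 ≤ m) (hx : x ∈ Icc (0 : ℝ) 1)
    (hf : ∀ r ∈ Icc (0 : ℝ) 1, |f r| ≤ ε + R * (m * Real.exp ((2 * R + 1) * r))) :
    |∫ r in (0 : ℝ)..x, f r| ≤ ε + m / 2 * Real.exp ((2 * R + 1) * x) := by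
  have hM : 0 < 2 * R + 1 := by positivity
  have hc : Continuous fun r => R * m * Real.exp ((2 * R + 1) * r) := by fun_prop
  have h1 : ‖∫ r in (0 : ℝ)..x, f r‖ ≤
      ∫ r in (0 : ℝ)..x, (ε + (R * m) * Real.exp ((2 * R + 1) * r)) := by
    refine intervalIntegral.norm_integral_le_of_norm_le hx.1 ?_
      ((continuous_const.add hc).intervalIntegrable _ _)
    refine Eventually.of_forall fun r hr => ?_
    rw [Real.norm_eq_abs, mul_assoc]
    exact hf r ⟨hr.1.le, hr.2.trans hx.2⟩
  rw [intervalIntegral.integral_add (by simp) (hc.intervalIntegrable _ _),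
    intervalIntegral.integral_const_mul, intervalIntegral.integral_const] at h1
  refine h1.trans (add_le_add ?_ ?_)
  · rw [smul_eq_mul, sub_zero]
    exact mul_le_of_le_one_left hε hx.2
  calc R * m * ∫ r in (0 : ℝ)..x, Real.exp ((2 * R + 1) * r)
      ≤ R * m * (Real.exp ((2 * R + 1) * x) / (2 * R + 1)) := by
        gcongr; exact integral_exp_mul_le hM
    _ = (R / (2 * R + 1)) * (m * Real.exp ((2 * R + 1) * x)) := by ring
    _ ≤ (1 / 2) * (m * Real.exp ((2 * R + 1) * x)) := by
        refine mul_le_mul_of_nonneg_right ?_ (by positivity)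
        rw [div_le_div_iff₀ hM two_pos]; linarith
    _ = _ := by ring

/-- The constant in the growth estimate for solutions of `y'' = V y` with `∫ |V| ≤ R`. -/
def growthConst (R : ℝ) : ℝ := (1 + R) * (2 * Real.exp (2 * R + 1))

theorem growthConst_pos {R : ℝ} (hR : 0 ≤ R) : 0 < growthConst R := by
  unfold growthConst; positivity

/-- A Gronwall estimate for `u'' = V u + h'`. -/
theorem abs_le_growthConst_mul {V u u₁ h : ℝ → ℝ} {ε R : ℝ}
    (hV : IntegrableOn V (Icc (0 : ℝ) 1)) (hR : ∫ r in (0 : ℝ)..1, |V r| ≤ R)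
    (hu : ContinuousOn u (Icc (0 : ℝ) 1)) (hh : ∀ x ∈ Icc (0 : ℝ) 1, |h x| ≤ ε)
    (h1 : ∀ x ∈ Icc (0 : ℝ) 1, u₁ x = h x + ∫ r in (0 : ℝ)..x, V r * u r)
    (h0 : ∀ x ∈ Icc (0 : ℝ) 1, u x = ∫ r in (0 : ℝ)..x, u₁ r) :
    ∀ x ∈ Icc (0 : ℝ) 1, |u x| ≤ growthConst R * ε ∧ |u₁ x| ≤ growthConst R * ε := by
  have hR0 : 0 ≤ R := le_trans (intervalIntegral.integral_nonneg zero_le_one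
    fun r _ => abs_nonneg (V r)) hR
  have hε : 0 ≤ ε := (abs_nonneg _).trans (hh 0 (left_mem_Icc.2 zero_le_one))
  set M := 2 * R + 1 with hMdef
  have hM : 0 < M := by positivity
  obtain ⟨x₀, hx₀, hmax⟩ := isCompact_Icc.exists_isMaxOn (nonempty_Icc.2 zero_le_one)
    (hu.abs.mul (by fun_prop : ContinuousOn (fun x => Real.exp (-(M * x))) (Icc (0 : ℝ) 1)))
  set m := |u x₀| * Real.exp (-(M * x₀)) with hm
  have hm0 : 0 ≤ m := by positivity
  have hum : ∀ x ∈ Icc (0 : ℝ) 1, |u x| ≤ m * Real.exp (M * x) := by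
    intro x hx
    have : |u x| * Real.exp (-(M * x)) ≤ m := hmax hx
    rwa [Real.exp_neg, ← div_eq_mul_inv, div_le_iff₀ (Real.exp_pos _)] at this
  have hVu : ∀ x ∈ Icc (0 : ℝ) 1,
      |∫ r in (0 : ℝ)..x, V r * u r| ≤ R * (m * Real.exp (M * x)) := by
    intro x hx
    refine abs_integral_mul_le_of_abs_le hV hR (by positivity) hx fun r hr => ?_
    refine (hum r ⟨hr.1, hr.2.trans hx.2⟩).trans ?_
    gcongr
    exact hr.2
  have hu1 : ∀ x ∈ Icc (0 : ℝ) 1, |u₁ x| ≤ ε + R * (m * Real.exp (M * x)) := by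
    intro x hx
    rw [h1 x hx]
    exact (abs_add_le _ _).trans (add_le_add (hh x hx) (hVu x hx))
  have hux : ∀ x ∈ Icc (0 : ℝ) 1, |u x| ≤ ε + m / 2 * Real.exp (M * x) := by
    intro x hx
    rw [h0 x hx]
    exact abs_integral_le_of_abs_le_add_exp hε hR0 hm0 hx hu1
  have hexp1 : ∀ x ∈ Icc (0 : ℝ) 1, 1 ≤ Real.exp (M * x) := fun x hx =>
    Real.one_le_exp (mul_nonneg hM.le hx.1)
  -- At a maximum point of the weighted |u|, the bound `hux` contains only half of the maximum,
  -- which is absorbed into the left side.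
  have hm2 : m ≤ 2 * ε := by
    have h2 := hux x₀ hx₀
    have h3 : |u x₀| = m * Real.exp (M * x₀) := by
      rw [hm, mul_assoc, ← Real.exp_add]; simp
    rw [h3] at h2
    nlinarith [hexp1 x₀ hx₀]
  intro x hx
  have hE : Real.exp (M * x) ≤ Real.exp M :=
    Real.exp_le_exp.2 (mul_le_of_le_one_right hM.le hx.2)
  have hE1 : 1 ≤ Real.exp M := Real.one_le_exp hM.le
  have hmE : m * Real.exp (M * x) ≤ 2 * ε * Real.exp M := by gcongr
  have hRE : R * (m * Real.exp (M * x)) ≤ R * (2 * ε * Real.exp M) := by gcongr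
  have hεE : ε ≤ 2 * ε * Real.exp M := by nlinarith
  have hRnn : 0 ≤ R * (2 * ε * Real.exp M) := by positivity
  have hG : growthConst R * ε = 2 * ε * Real.exp M + R * (2 * ε * Real.exp M) := by
    unfold growthConst; rw [← hMdef]; ring
  rw [hG]
  exact ⟨by linarith [hum x hx], by linarith [hu1 x hx]⟩

namespace IsIVPSolution

variable {V W y y₁ z z₁ : ℝ → ℝ} {c d : ℝ}

theorem continuousOn_deriv (h : IsIVPSolution V c y y₁) (hV : IntegrableOn V (Icc (0 : ℝ) 1)) :
    ContinuousOn y₁ (Icc (0 : ℝ) 1) :=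
  (continuousOn_const.add (continuousOn_primitive_unit
    (integrableOn_mul_of_continuousOn hV h.continuousOn))).congr h.deriv_eq

theorem zero (h : IsIVPSolution V c y y₁) : y 0 = 0 := by
  simpa using h.eq 0 (left_mem_Icc.2 zero_le_one)

theorem deriv_zero (h : IsIVPSolution V c y y₁) : y₁ 0 = c := by
  simpa using h.deriv_eq 0 (left_mem_Icc.2 zero_le_one)

theorem congr (h : IsIVPSolution V c y y₁) (hVW : V =ᵐ[unitMeasure] W) :
    IsIVPSolution W c y y₁ := by
  refine ⟨h.continuousOn, fun x hx => ?_, h.eq⟩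
  rw [h.deriv_eq x hx]
  congr 1
  refine intervalIntegral.integral_congr_ae ?_
  have := (ae_restrict_iff' measurableSet_Icc).1 hVW
  filter_upwards [this] with r hr hr'
  rw [uIoc_of_le hx.1] at hr'
  rw [hr ⟨hr'.1.le, hr'.2.trans hx.2⟩]

theorem const_mul (h : IsIVPSolution V c y y₁) (a : ℝ) :
    IsIVPSolution V (a * c) (fun x => a * y x) (fun x => a * y₁ x) := by
  refine ⟨continuousOn_const.mul h.continuousOn, fun x hx => ?_, fun x hx => ?_⟩
  · rw [h.deriv_eq x hx, mul_add, ← intervalIntegral.integral_const_mul]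
    simp only [mul_left_comm]
  · rw [h.eq x hx, intervalIntegral.integral_const_mul]

/-- Growth of solutions. -/
theorem abs_le {R : ℝ} (h : IsIVPSolution V c y y₁) (hV : IntegrableOn V (Icc (0 : ℝ) 1))
    (hR : ∫ r in (0 : ℝ)..1, |V r| ≤ R) :
    ∀ x ∈ Icc (0 : ℝ) 1, |y x| ≤ growthConst R * |c| ∧ |y₁ x| ≤ growthConst R * |c| :=
  abs_le_growthConst_mul (h := fun _ => c) hV hR h.continuousOn (fun _ _ => le_rfl)
    h.deriv_eq h.eq

/-- Lipschitz dependence of solutions on the potential. -/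
theorem abs_sub_le {R η : ℝ} (h : IsIVPSolution V 1 y y₁) (h' : IsIVPSolution W 1 z z₁)
    (hV : IntegrableOn V (Icc (0 : ℝ) 1)) (hW : IntegrableOn W (Icc (0 : ℝ) 1))
    (hR : ∫ r in (0 : ℝ)..1, |V r| ≤ R) (hR' : ∫ r in (0 : ℝ)..1, |W r| ≤ R)
    (hη : ∫ r in (0 : ℝ)..1, |V r - W r| ≤ η) :
    ∀ x ∈ Icc (0 : ℝ) 1, |y x - z x| ≤ growthConst R ^ 2 * η ∧
      |y₁ x - z₁ x| ≤ growthConst R ^ 2 * η := by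
  have hR0 : 0 ≤ R := le_trans (intervalIntegral.integral_nonneg zero_le_one
    fun r _ => abs_nonneg (V r)) hR
  have hG := growthConst_pos hR0
  -- The difference solves u'' = V u + (V - W) z with zero initial data, so the forcing term is a
  -- primitive of (V - W) z.
  have key := abs_le_growthConst_mul (V := V) (u := fun x => y x - z x)
    (u₁ := fun x => y₁ x - z₁ x) (h := fun x => ∫ r in (0 : ℝ)..x, (V r - W r) * z r)
    (ε := growthConst R * η) hV hR (h.continuousOn.sub h'.continuousOn) ?_ ?_ ?_
  · intro x hx
    have := key x hx
    rw [← mul_assoc, ← sq] at this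
    exact this
  · intro x hx
    refine (abs_integral_mul_le_of_abs_le (hV.sub hW) hη hG.le hx fun r hr => ?_).trans_eq
      (mul_comm _ _)
    simpa using (h'.abs_le hW hR' r ⟨hr.1, hr.2.trans hx.2⟩).1
  · intro x hx
    have i1 := intervalIntegrable_of_mem_Icc
      (integrableOn_mul_of_continuousOn (hV.sub hW) h'.continuousOn) hx
    have i2 := intervalIntegrable_of_mem_Icc
      (integrableOn_mul_of_continuousOn hV (h.continuousOn.sub h'.continuousOn)) hx
    have i3 := intervalIntegrable_of_mem_Icc (integrableOn_mul_of_continuousOn hV h.continuousOn) hx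
    have i4 := intervalIntegrable_of_mem_Icc
      (integrableOn_mul_of_continuousOn hW h'.continuousOn) hx
    simp only [Pi.sub_apply] at i1 i2
    rw [h.deriv_eq x hx, h'.deriv_eq x hx, ← intervalIntegral.integral_add i1 i2,
      add_sub_add_left_eq_sub, ← intervalIntegral.integral_sub i3 i4]
    congr 1
    ext r
    ring
  · intro x hx
    rw [h.eq x hx, h'.eq x hx, ← intervalIntegral.integral_sub]
    · exact intervalIntegrable_of_mem_Icc (h.continuousOn_deriv hV).integrableOn_Icc hx
    · exact intervalIntegrable_of_mem_Icc (h'.continuousOn_deriv hW).integrableOn_Icc hx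

theorem eqOn (h : IsIVPSolution V 1 y y₁) (h' : IsIVPSolution V 1 z z₁)
    (hV : IntegrableOn V (Icc (0 : ℝ) 1)) :
    EqOn y z (Icc (0 : ℝ) 1) ∧ EqOn y₁ z₁ (Icc (0 : ℝ) 1) := by
  have := h.abs_sub_le h' hV hV (R := ∫ r in (0 : ℝ)..1, |V r|) le_rfl le_rfl (η := 0) (by simp)
  constructor <;> intro x hx
  · exact sub_eq_zero.1 (abs_nonpos_iff.1 (by simpa using (this x hx).1))
  · exact sub_eq_zero.1 (abs_nonpos_iff.1 (by simpa using (this x hx).2))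

/-- The solutions vanishing at 0 form a line. Slope zero is settled by the growth bound, any other
slope by rescaling to slope one. -/
theorem eqOn_mul (h : IsIVPSolution V c y y₁) (h' : IsIVPSolution V 1 z z₁)
    (hV : IntegrableOn V (Icc (0 : ℝ) 1)) :
    EqOn y (fun x => c * z x) (Icc (0 : ℝ) 1) := by
  by_cases hc : c = 0
  · intro x hx
    have := (h.abs_le hV (R := ∫ r in (0 : ℝ)..1, |V r|) le_rfl x hx).1
    simpa [hc] using this
  · intro x hx
    have h1 := h.const_mul c⁻¹
    rw [inv_mul_cancel₀ hc] at h1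
    have := (h1.eqOn h' hV).1 hx
    simp only at this ⊢
    rw [← this]
    field_simp

end IsIVPSolution

/-- The product rule for primitives of integrable functions. -/
theorem integral_mul_add_mul_of_primitive {F G f g : ℝ → ℝ}
    (hf : IntegrableOn f (Icc (0 : ℝ) 1)) (hg : IntegrableOn g (Icc (0 : ℝ) 1))
    (hF : ∀ x ∈ Icc (0 : ℝ) 1, F x = F 0 + ∫ r in (0 : ℝ)..x, f r)
    (hG : ∀ x ∈ Icc (0 : ℝ) 1, G x = G 0 + ∫ r in (0 : ℝ)..x, g r) :
    ∫ x in (0 : ℝ)..1, (f x * G x + F x * g x) = F 1 * G 1 - F 0 * G 0 := by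
  have h1 : (1 : ℝ) ∈ Icc (0 : ℝ) 1 := right_mem_Icc.2 zero_le_one
  have hfi := intervalIntegrable_of_mem_Icc hf h1
  have hgi := intervalIntegrable_of_mem_Icc hg h1
  -- Since f and g are only integrable, their primitives are differentiable merely almost
  -- everywhere; absolute continuity is what justifies integrating by parts.
  have ac : ∀ (a : ℝ) {f : ℝ → ℝ}, IntervalIntegrable f volume 0 1 →
      AbsolutelyContinuousOnInterval (fun x => a + ∫ r in (0 : ℝ)..x, f r) 0 1 := by
    intro a f hf
    have h2 : AbsolutelyContinuousOnInterval (fun _ : ℝ => a) 0 1 :=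
      (LipschitzWith.const a).lipschitzOnWith.absolutelyContinuousOnInterval
    exact h2.add (hf.absolutelyContinuousOnInterval_intervalIntegral (by simp))
  have key := AbsolutelyContinuousOnInterval.integral_deriv_mul_eq_sub (ac (F 0) hfi) (ac (G 0) hgi)
  rw [← hF 1 h1, ← hG 1 h1] at key
  simp only [intervalIntegral.integral_same, add_zero] at key
  rw [← key]
  refine intervalIntegral.integral_congr_ae ?_
  filter_upwards [hfi.ae_hasDerivAt_integral, hgi.ae_hasDerivAt_integral] with x hx hx' hm
  have hm' : x ∈ uIcc (0 : ℝ) 1 := uIoc_subset_uIcc hm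
  rw [((hx hm' 0 (by simp)).const_add (F 0)).deriv, ((hx' hm' 0 (by simp)).const_add (G 0)).deriv]
  rw [uIcc_of_le zero_le_one] at hm'
  rw [← hF x hm', ← hG x hm']

/-- The Wronskian identity for two Dirichlet solutions. -/
theorem IsIVPSolution.integral_sub_mul_mul_eq_zero {V W y y₁ z z₁ : ℝ → ℝ} {c d : ℝ}
    (h : IsIVPSolution V c y y₁) (h' : IsIVPSolution W d z z₁)
    (hV : IntegrableOn V (Icc (0 : ℝ) 1)) (hW : IntegrableOn W (Icc (0 : ℝ) 1))
    (hy : y 1 = 0) (hz : z 1 = 0) :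
    ∫ x in (0 : ℝ)..1, (V x - W x) * (y x * z x) = 0 := by
  have h1 : (1 : ℝ) ∈ Icc (0 : ℝ) 1 := right_mem_Icc.2 zero_le_one
  have iy := integrableOn_mul_of_continuousOn hV h.continuousOn
  have iz := integrableOn_mul_of_continuousOn hW h'.continuousOn
  have cy := h.continuousOn_deriv hV
  have cz := h'.continuousOn_deriv hW
  -- `e1` integrates (y'z)' and `e2` integrates (z'y)'. The terms y'z' cancel in the difference, and
  -- the boundary terms vanish.
  have e1 := integral_mul_add_mul_of_primitive iy cz.integrableOn_Icc
    (F := y₁) (G := z) (fun x hx => by rw [h.deriv_zero, h.deriv_eq x hx])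
    (fun x hx => by rw [h'.zero, zero_add, h'.eq x hx])
  have e2 := integral_mul_add_mul_of_primitive iz cy.integrableOn_Icc
    (F := z₁) (G := y) (fun x hx => by rw [h'.deriv_zero, h'.deriv_eq x hx])
    (fun x hx => by rw [h.zero, zero_add, h.eq x hx])
  have j1 := ((iy.mul_continuousOn h'.continuousOn isCompact_Icc).add
    (cy.mul cz).integrableOn_Icc)
  have j2 := ((iz.mul_continuousOn h.continuousOn isCompact_Icc).add
    (cz.mul cy).integrableOn_Icc)
  have e3 := intervalIntegral.integral_sub (intervalIntegrable_of_mem_Icc j1 h1)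
    (intervalIntegrable_of_mem_Icc j2 h1)
  simp only [Pi.add_apply, Pi.mul_apply] at e3
  rw [e1, e2, hy, hz, h.zero, h'.zero] at e3
  simp only [mul_zero, sub_zero] at e3
  rw [← e3]
  congr 1
  ext x
  ring

/-- Existence of the solution of `y'' = V y`, `y(0) = 0`, `y'(0) = 1`. -/
theorem exists_isIVPSolution {V : ℝ → ℝ} (hV : IntegrableOn V (Icc (0 : ℝ) 1)) :
    ∃ y y₁, IsIVPSolution V 1 y y₁ := by
  set R := ∫ r in (0 : ℝ)..1, |V r| with hRdef
  have hR0 : 0 ≤ R := intervalIntegral.integral_nonneg zero_le_one fun r _ => abs_nonneg (V r)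
  set M := 2 * R + 1 with hM
  -- The unknown is z = e^{-Mx} y, so that the Volterra operator is a 1/2-contraction in the
  -- ordinary sup norm.
  let w : C(Icc (0 : ℝ) 1, ℝ) → ℝ → ℝ := fun z r =>
    IccExtend (zero_le_one (α := ℝ)) z r * Real.exp (M * r)
  have hw : ∀ z, Continuous (w z) := fun z =>
    (z.continuous.Icc_extend' (h := zero_le_one)).mul (by fun_prop)
  let w₁ : C(Icc (0 : ℝ) 1, ℝ) → ℝ → ℝ := fun z r => 1 + ∫ r' in (0 : ℝ)..r, V r' * w z r'
  have hi : ∀ z, IntegrableOn (fun r => V r * w z r) (Icc (0 : ℝ) 1) := fun z =>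
    integrableOn_mul_of_continuousOn hV (hw z).continuousOn
  have hw₁ : ∀ z, ContinuousOn (w₁ z) (Icc (0 : ℝ) 1) := fun z =>
    continuousOn_const.add (continuousOn_primitive_unit (hi z))
  have hcont : ∀ z, ContinuousOn (fun x => Real.exp (-(M * x)) * ∫ r in (0 : ℝ)..x, w₁ z r)
      (Icc (0 : ℝ) 1) := fun z =>
    ContinuousOn.mul (by fun_prop) (continuousOn_primitive_unit (hw₁ z).integrableOn_Icc)
  let T : C(Icc (0 : ℝ) 1, ℝ) → C(Icc (0 : ℝ) 1, ℝ) := fun z =>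
    ⟨fun x => Real.exp (-(M * x)) * ∫ r in (0 : ℝ)..x, w₁ z r,
      continuousOn_iff_continuous_domRestrict.1 (hcont z)⟩
  have hT : ContractingWith (1 / 2) T := by
    refine ⟨NNReal.half_lt_self one_ne_zero, LipschitzWith.of_dist_le_mul fun z z' => ?_⟩
    rw [ContinuousMap.dist_le (by positivity)]
    rintro ⟨x, hx⟩
    have hd : ∀ r ∈ Icc (0 : ℝ) 1, |w z r - w z' r| ≤ dist z z' * Real.exp (M * r) := by
      intro r hr
      simp only [w, IccExtend_of_mem _ _ hr]
      rw [← sub_mul, abs_mul, abs_of_pos (Real.exp_pos _)]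
      gcongr
      exact ContinuousMap.dist_apply_le_dist (f := z) (g := z') ⟨r, hr⟩
    have hd₁ : ∀ r ∈ Icc (0 : ℝ) 1,
        |w₁ z r - w₁ z' r| ≤ 0 + R * (dist z z' * Real.exp (M * r)) := by
      intro r hr
      have : w₁ z r - w₁ z' r = ∫ r' in (0 : ℝ)..r, V r' * (w z r' - w z' r') := by
        simp only [w₁]
        rw [add_sub_add_left_eq_sub, ← intervalIntegral.integral_sub
          (intervalIntegrable_of_mem_Icc (hi z) hr) (intervalIntegrable_of_mem_Icc (hi z') hr)]
        simp only [mul_sub]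
      rw [this, zero_add]
      refine abs_integral_mul_le_of_abs_le hV le_rfl (by positivity) hr fun t ht => ?_
      refine (hd t ⟨ht.1, ht.2.trans hr.2⟩).trans ?_
      gcongr
      exact ht.2
    have hd₂ := abs_integral_le_of_abs_le_add_exp le_rfl hR0 dist_nonneg hx hd₁
    rw [intervalIntegral.integral_sub
      (intervalIntegrable_of_mem_Icc (hw₁ z).integrableOn_Icc hx)
      (intervalIntegrable_of_mem_Icc (hw₁ z').integrableOn_Icc hx), zero_add] at hd₂
    change |Real.exp (-(M * x)) * (∫ r in (0 : ℝ)..x, w₁ z r) -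
      Real.exp (-(M * x)) * (∫ r in (0 : ℝ)..x, w₁ z' r)| ≤ _
    rw [← mul_sub, abs_mul, abs_of_pos (Real.exp_pos _), Real.exp_neg, inv_mul_le_iff₀
      (Real.exp_pos _)]
    refine hd₂.trans_eq ?_
    push_cast
    ring
  obtain ⟨z, hz⟩ : ∃ z, T z = z := ⟨_, hT.fixedPoint_isFixedPt⟩
  refine ⟨w z, w₁ z, (hw z).continuousOn, fun x _ => rfl, fun x hx => ?_⟩
  have h1 : (T z) ⟨x, hx⟩ = z ⟨x, hx⟩ := by rw [hz]
  simp only [w, IccExtend_of_mem _ _ hx]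
  rw [← h1]
  change Real.exp (-(M * x)) * (∫ r in (0 : ℝ)..x, w₁ z r) * _ = _
  rw [Real.exp_neg, mul_right_comm, inv_mul_cancel₀ (Real.exp_pos _).ne', one_mul]

/-! ### Dirichlet eigenvalues and eigenfunctions through the initial value problem -/

theorem integrableOn_potential (q : UnitL2) (lam : ℝ) :
    IntegrableOn (fun x => q x - lam) (Icc (0 : ℝ) 1) :=
  ((Lp.memLp q).integrable (by norm_num)).sub (integrable_const lam)

theorem memLp_potential (q : UnitL2) (lam : ℝ) :
    MemLp (fun x => q x - lam) 2 unitMeasure :=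
  (Lp.memLp q).sub (memLp_const lam)

theorem IsDirichletSolution.isIVPSolution {q : UnitL2} {lam : ℝ} {φ φ₁ : ℝ → ℝ}
    (h : IsDirichletSolution q lam φ φ₁) :
    IsIVPSolution (fun x => q x - lam) (φ₁ 0) φ φ₁ ∧ φ 1 = 0 := by
  obtain ⟨φ₂, h2, h0, h1, hae⟩ := h
  have hint : IntegrableOn φ₂ (Icc (0 : ℝ) 1) := h2.memLp.integrable (by norm_num)
  have hc1 : ContinuousOn φ₁ (Icc (0 : ℝ) 1) :=
    (continuousOn_const.add (continuousOn_primitive_unit hint)).congr h2.eq_one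
  have hc0 : ContinuousOn φ (Icc (0 : ℝ) 1) :=
    (continuousOn_const.add (continuousOn_primitive_unit hc1.integrableOn_Icc)).congr h2.eq_zero
  refine ⟨⟨hc0, fun x hx => ?_, fun x hx => by rw [h2.eq_zero x hx, h0, zero_add]⟩, h1⟩
  rw [h2.eq_one x hx]
  congr 1
  refine intervalIntegral.integral_congr_ae ?_
  filter_upwards [(ae_restrict_iff' measurableSet_Icc).1 hae] with r hr hr'
  rw [uIoc_of_le hx.1] at hr'
  linarith [hr ⟨hr'.1.le, hr'.2.trans hx.2⟩]

theorem IsIVPSolution.isDirichletSolution {q : UnitL2} {lam c : ℝ} {y y₁ : ℝ → ℝ}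
    (h : IsIVPSolution (fun x => q x - lam) c y y₁) (h1 : y 1 = 0) :
    IsDirichletSolution q lam y y₁ := by
  refine ⟨fun x => (q x - lam) * y x, ⟨?_, fun x hx => ?_, fun x hx => ?_⟩, h.zero, h1, ?_⟩
  · obtain ⟨C, hC⟩ := isCompact_Icc.exists_bound_of_continuousOn h.continuousOn
    refine (memLp_potential q lam).of_le_mul (c := C)
      ((memLp_potential q lam).aestronglyMeasurable.mul
        (h.continuousOn.aestronglyMeasurable measurableSet_Icc)) ?_
    refine (ae_restrict_iff' measurableSet_Icc).2 (Eventually.of_forall fun x hx => ?_)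
    rw [norm_mul, mul_comm]
    exact mul_le_mul_of_nonneg_right (hC x hx) (norm_nonneg _)
  · rw [h.deriv_zero, h.deriv_eq x hx]
  · rw [h.zero, zero_add, h.eq x hx]
  · exact Eventually.of_forall fun x => by ring

theorem IsIVPSolution.exists_ne_zero {V y y₁ : ℝ → ℝ} (h : IsIVPSolution V 1 y y₁) :
    ∃ x ∈ Icc (0 : ℝ) 1, y x ≠ 0 := by
  by_contra! hz
  have h1 : (1 : ℝ) ∈ Icc (0 : ℝ) 1 := right_mem_Icc.2 zero_le_one
  have hd : ∀ x ∈ Icc (0 : ℝ) 1, y₁ x = 1 := by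
    intro x hx
    rw [h.deriv_eq x hx, intervalIntegral.integral_congr (g := fun _ => (0 : ℝ))]
    · simp
    · intro r hr
      rw [uIcc_of_le hx.1] at hr
      simp [hz r ⟨hr.1, hr.2.trans hx.2⟩]
  have := h.eq 1 h1
  rw [hz 1 h1, intervalIntegral.integral_congr (g := fun _ => (1 : ℝ))] at this
  · norm_num at this
  · intro r hr
    rw [uIcc_of_le zero_le_one] at hr
    exact hd r hr

theorem IsIVPSolution.integral_sq_pos {V y y₁ : ℝ → ℝ} (h : IsIVPSolution V 1 y y₁) :
    0 < ∫ x in (0 : ℝ)..1, y x ^ 2 := by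
  obtain ⟨x, hx, hne⟩ := h.exists_ne_zero
  exact intervalIntegral.integral_pos zero_lt_one (h.continuousOn.pow 2)
    (fun _ _ => sq_nonneg _) ⟨x, hx, by positivity⟩

/-- Shooting: one solution decides, because all solutions vanishing at 0 are multiples of it.
Spectral questions become questions about zeros of a function of `q` and `lam`. -/
theorem isDirichletEigenvalue_iff {q : UnitL2} {lam : ℝ} {y y₁ : ℝ → ℝ}
    (h : IsIVPSolution (fun x => q x - lam) 1 y y₁) :
    IsDirichletEigenvalue q lam ↔ y 1 = 0 := by
  constructor
  · rintro ⟨φ, φ₁, hφ, x, hx, hne⟩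
    obtain ⟨hi, h1⟩ := hφ.isIVPSolution
    have e := hi.eqOn_mul h (integrableOn_potential q lam)
    have e1 := e (right_mem_Icc.2 zero_le_one)
    have ex := e hx
    simp only at e1 ex
    rw [h1] at e1
    rcases mul_eq_zero.1 e1.symm with h0 | h0
    · rw [h0, zero_mul] at ex
      exact absurd ex hne
    · exact h0
  · exact fun h1 => ⟨y, y₁, h.isDirichletSolution h1, h.exists_ne_zero⟩

theorem isNormalizedEigenfunction_of_isIVPSolution {q : UnitL2} {lam : ℝ} {y y₁ : ℝ → ℝ}
    (h : IsIVPSolution (fun x => q x - lam) 1 y y₁) (h1 : y 1 = 0) :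
    IsNormalizedEigenfunction q lam
      (fun x => (Real.sqrt (∫ x in (0 : ℝ)..1, y x ^ 2))⁻¹ * y x) := by
  have hN := h.integral_sq_pos
  refine ⟨_, (h.const_mul _).isDirichletSolution (by rw [h1, mul_zero]), ?_, ?_⟩
  · simp only [mul_pow]
    rw [intervalIntegral.integral_const_mul, inv_pow, Real.sq_sqrt hN.le,
      inv_mul_cancel₀ hN.ne']
  · rw [h.deriv_zero]
    positivity

/-- The unit norm fixes the slope at 0 up to sign and its positivity fixes the sign, so the choice
in `dirichletEigenfunction` is harmless on [0, 1]. -/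
theorem IsNormalizedEigenfunction.eqOn {q : UnitL2} {lam : ℝ} {φ y y₁ : ℝ → ℝ}
    (hφ : IsNormalizedEigenfunction q lam φ)
    (h : IsIVPSolution (fun x => q x - lam) 1 y y₁) :
    EqOn φ (fun x => (Real.sqrt (∫ x in (0 : ℝ)..1, y x ^ 2))⁻¹ * y x) (Icc (0 : ℝ) 1) := by
  obtain ⟨φ₁, hs, hn, hpos⟩ := hφ
  have e := hs.isIVPSolution.1.eqOn_mul h (integrableOn_potential q lam)
  have hN := h.integral_sq_pos
  have e2 : ∫ x in (0 : ℝ)..1, φ x ^ 2 = φ₁ 0 ^ 2 * ∫ x in (0 : ℝ)..1, y x ^ 2 := by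
    rw [← intervalIntegral.integral_const_mul]
    refine intervalIntegral.integral_congr fun x hx => ?_
    rw [uIcc_of_le zero_le_one] at hx
    simp only [e hx]
    ring
  rw [hn] at e2
  have e3 : φ₁ 0 = (Real.sqrt (∫ x in (0 : ℝ)..1, y x ^ 2))⁻¹ := by
    rw [← Real.sqrt_inv, eq_comm, Real.sqrt_eq_iff_mul_self_eq_of_pos hpos, ← sq]
    field_simp
    linarith
  rw [← e3]
  exact e

theorem dirichletEigenfunction_eqOn {q : UnitL2} {n : ℕ} {y y₁ : ℝ → ℝ}
    (h : IsIVPSolution (fun x => q x - dirichletEigenvalue q n) 1 y y₁) (h1 : y 1 = 0) :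
    EqOn (dirichletEigenfunction q n)
      (fun x => (Real.sqrt (∫ x in (0 : ℝ)..1, y x ^ 2))⁻¹ * y x) (Icc (0 : ℝ) 1) := by
  have hex : ∃ φ, IsNormalizedEigenfunction q (dirichletEigenvalue q n) φ :=
    ⟨_, isNormalizedEigenfunction_of_isIVPSolution h h1⟩
  rw [dirichletEigenfunction, dif_pos hex]
  exact hex.choose_spec.eqOn h

theorem IsIVPSolution.hasDerivAt {V y y₁ : ℝ → ℝ} {c : ℝ} (h : IsIVPSolution V c y y₁)
    (hV : IntegrableOn V (Icc (0 : ℝ) 1)) {x : ℝ} (hx : x ∈ Ioo (0 : ℝ) 1) :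
    HasDerivAt y (y₁ x) x := by
  have hc := h.continuousOn_deriv hV
  have hnhds : Icc (0 : ℝ) 1 ∈ 𝓝 x := Icc_mem_nhds hx.1 hx.2
  have hd := intervalIntegral.integral_hasDerivAt_right
    (intervalIntegrable_of_mem_Icc hc.integrableOn_Icc ⟨hx.1.le, hx.2.le⟩)
    ⟨Icc (0 : ℝ) 1, hnhds, hc.integrableOn_Icc.aestronglyMeasurable⟩ (hc.continuousAt hnhds)
  refine hd.congr_of_eventuallyEq ?_
  filter_upwards [hnhds] with y hy using h.eq y hy

theorem vectorField_ae_eq {q : UnitL2} {n : ℕ} {y y₁ : ℝ → ℝ}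
    (h : IsIVPSolution (fun x => q x - dirichletEigenvalue q n) 1 y y₁) (h1 : y 1 = 0) :
    vectorField n q =ᵐ[unitMeasure]
      fun x => 4 * (y x * y₁ x) / ∫ x in (0 : ℝ)..1, y x ^ 2 := by
  refine (MemLp.coeFn_toLp _).trans ?_
  rw [unitMeasure, ← restrict_Ioo_eq_restrict_Icc]
  refine (ae_restrict_iff' measurableSet_Ioo).2 (Eventually.of_forall fun x hx => ?_)
  have hN := h.integral_sq_pos
  have hd : HasDerivAt (fun x => dirichletEigenfunction q n x ^ 2) _ x :=
    (((h.hasDerivAt (integrableOn_potential _ _) hx).const_mul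
      (Real.sqrt (∫ x in (0 : ℝ)..1, y x ^ 2))⁻¹).pow 2).congr_of_eventuallyEq (by
        filter_upwards [Icc_mem_nhds hx.1 hx.2] with r hr
        simp [dirichletEigenfunction_eqOn h h1 hr])
  rw [vectorFieldFun, hd.deriv]
  have hs := Real.mul_self_sqrt hN.le
  have hs0 := (Real.sqrt_pos.2 hN).ne'
  rw [eq_div_iff hN.ne']
  -- The first two occurrences of ∫ y² stand under square roots; only the third, the free factor, is
  -- to be split into roots.
  nth_rewrite 3 [← hs]
  norm_num
  field_simp
  ring

/-- The quotient (∫ y)²/∫ y² is invariant under scaling, so any nonzero eigenfunction may replace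
the normalized one. -/
theorem heatContentTerm_eq {q : UnitL2} {n : ℕ} {c : ℝ} {y y₁ : ℝ → ℝ} (t : ℝ) (hc : c ≠ 0)
    (h : IsIVPSolution (fun x => q x - dirichletEigenvalue q n) c y y₁) (h1 : y 1 = 0) :
    heatContentTerm q t n = Real.exp (-t * dirichletEigenvalue q n) *
      ((∫ x in (0 : ℝ)..1, y x) ^ 2 / ∫ x in (0 : ℝ)..1, y x ^ 2) := by
  have h' := h.const_mul c⁻¹
  rw [inv_mul_cancel₀ hc] at h'
  have hN := h'.integral_sq_pos
  rw [heatContentTerm, intervalIntegral.integral_congr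
    (g := fun x => (Real.sqrt (∫ x in (0 : ℝ)..1, (c⁻¹ * y x) ^ 2))⁻¹ * (c⁻¹ * y x)),
    intervalIntegral.integral_const_mul, mul_pow, inv_pow, Real.sq_sqrt hN.le, inv_mul_eq_div]
  · simp only [mul_pow, intervalIntegral.integral_const_mul]
    rw [mul_div_mul_left _ _ (pow_ne_zero 2 (inv_ne_zero hc))]
  · rw [uIcc_of_le zero_le_one]
    exact dirichletEigenfunction_eqOn h' (by rw [h1, mul_zero])

/-- Identification of the `n`-th eigenvalue from a list of all eigenvalues up to it. -/
theorem dirichletEigenvalue_eq {q : UnitL2} {n : ℕ} (hn : 1 ≤ n) {μ : ℕ → ℝ}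
    (hmono : StrictMonoOn μ (Icc 1 n)) (hμ : ∀ j ∈ Icc 1 n, IsDirichletEigenvalue q (μ j))
    (hall : ∀ lam ≤ μ n, IsDirichletEigenvalue q lam → ∃ j ∈ Icc 1 n, lam = μ j) :
    dirichletEigenvalue q n = μ n := by
  have hnn : n ∈ Icc 1 n := ⟨hn, le_rfl⟩
  have hset : {x : ℝ | IsDirichletEigenvalue q x ∧ x < μ n} = μ '' (Ico 1 n) := by
    ext x
    constructor
    · rintro ⟨hx, hlt⟩
      obtain ⟨j, hj, rfl⟩ := hall x hlt.le hx
      refine ⟨j, ⟨hj.1, lt_of_le_of_ne hj.2 ?_⟩, rfl⟩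
      rintro rfl
      exact lt_irrefl _ hlt
    · rintro ⟨j, hj, rfl⟩
      exact ⟨hμ j ⟨hj.1, hj.2.le⟩, hmono ⟨hj.1, hj.2.le⟩ hnn hj.2⟩
  have hcard : {x : ℝ | IsDirichletEigenvalue q x ∧ x < μ n}.encard + 1 = (n : ℕ∞) := by
    rw [hset, (hmono.injOn.mono Ico_subset_Icc_self).encard_image,
      ← Finset.coe_Ico, Set.encard_coe_eq_coe_finsetCard, Nat.card_Ico]
    exact_mod_cast Nat.sub_add_cancel hn
  -- Passing from an eigenvalue `a` to a larger `b` adds at least `a` itself to the eigenvalues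
  -- counted, so equal finite counts exclude a < b.
  have hlt : ∀ a b : ℝ, IsDirichletEigenvalue q a →
      {x : ℝ | IsDirichletEigenvalue q x ∧ x < a}.encard + 1 = (n : ℕ∞) →
      {x : ℝ | IsDirichletEigenvalue q x ∧ x < b}.encard + 1 = (n : ℕ∞) → ¬ a < b := by
    intro a b ha hca hcb hab
    have hsub : insert a {x : ℝ | IsDirichletEigenvalue q x ∧ x < a} ⊆
        {x : ℝ | IsDirichletEigenvalue q x ∧ x < b} := by
      rintro x (rfl | hx)
      · exact ⟨ha, hab⟩
      · exact ⟨hx.1, hx.2.trans hab⟩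
    have h1 := Set.encard_le_encard hsub
    rw [Set.encard_insert_of_notMem (fun h => lt_irrefl _ h.2), hca] at h1
    have h2 : (n : ℕ∞) + 1 ≤ n := by
      rw [← hcb] at h1 ⊢
      exact add_le_add_left h1 1
    exact absurd h2 (by exact_mod_cast Nat.not_succ_le_self n)
  have : {lam : ℝ | IsDirichletEigenvalue q lam ∧
      {x : ℝ | IsDirichletEigenvalue q x ∧ x < lam}.encard + 1 = (n : ℕ∞)} = {μ n} := by
    ext lam
    constructor
    · rintro ⟨h1, h2⟩
      exact le_antisymm (not_lt.1 (hlt _ _ (hμ n hnn) hcard h2)) (not_lt.1 (hlt _ _ h1 h2 hcard))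
    · rintro rfl
      exact ⟨hμ n hnn, hcard⟩
  rw [dirichletEigenvalue, this, csInf_singleton]

/-- Classical solutions solve the initial value problem. -/
theorem IsIVPSolution.of_hasDerivAt {V y y₁ : ℝ → ℝ} {c : ℝ} (hV : ContinuousOn V (Icc (0 : ℝ) 1))
    (hy : ∀ x ∈ Icc (0 : ℝ) 1, HasDerivAt y (y₁ x) x)
    (hy₁ : ∀ x ∈ Icc (0 : ℝ) 1, HasDerivAt y₁ (V x * y x) x) (h0 : y 0 = 0) (h1 : y₁ 0 = c) :
    IsIVPSolution V c y y₁ := by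
  have hc : ContinuousOn y (Icc (0 : ℝ) 1) := fun x hx => (hy x hx).continuousAt.continuousWithinAt
  have hc₁ : ContinuousOn y₁ (Icc (0 : ℝ) 1) := fun x hx =>
    (hy₁ x hx).continuousAt.continuousWithinAt
  have hsub : ∀ x ∈ Icc (0 : ℝ) 1, uIcc 0 x ⊆ Icc (0 : ℝ) 1 := fun x hx => by
    rw [uIcc_of_le hx.1]; exact Icc_subset_Icc_right hx.2
  refine ⟨hc, fun x hx => ?_, fun x hx => ?_⟩
  · rw [intervalIntegral.integral_eq_sub_of_hasDerivAt (fun r hr => hy₁ r (hsub x hx hr))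
      (intervalIntegrable_of_mem_Icc (hV.mul hc).integrableOn_Icc hx), h1]
    ring
  · rw [intervalIntegral.integral_eq_sub_of_hasDerivAt (fun r hr => hy r (hsub x hx hr))
      (intervalIntegrable_of_mem_Icc hc₁.integrableOn_Icc hx), h0, sub_zero]

/-! ### Explicit solutions and spectrum of the free equation -y'' = λy -/

theorem hasDerivAt_sin_mul_div {a : ℝ} (ha : a ≠ 0) (x : ℝ) :
    HasDerivAt (fun x => Real.sin (a * x) / a) (Real.cos (a * x)) x := by
  have hl : HasDerivAt (fun x => a * x) a x := by simpa using (hasDerivAt_id x).const_mul a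
  have := hl.sin.div_const a
  rwa [mul_div_cancel_right₀ _ ha] at this

theorem hasDerivAt_cos_mul {a lam : ℝ} (ha : a * a = lam) (h0 : a ≠ 0) (x : ℝ) :
    HasDerivAt (fun x => Real.cos (a * x)) (-lam * (Real.sin (a * x) / a)) x := by
  have hl : HasDerivAt (fun x => a * x) a x := by simpa using (hasDerivAt_id x).const_mul a
  refine hl.cos.congr_deriv ?_
  rw [← ha]
  field_simp

theorem hasDerivAt_sinh_mul_div {a : ℝ} (ha : a ≠ 0) (x : ℝ) :
    HasDerivAt (fun x => Real.sinh (a * x) / a) (Real.cosh (a * x)) x := by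
  have hl : HasDerivAt (fun x => a * x) a x := by simpa using (hasDerivAt_id x).const_mul a
  have := hl.sinh.div_const a
  rwa [mul_div_cancel_right₀ _ ha] at this

theorem hasDerivAt_cosh_mul {a lam : ℝ} (ha : a * a = -lam) (h0 : a ≠ 0) (x : ℝ) :
    HasDerivAt (fun x => Real.cosh (a * x)) (-lam * (Real.sinh (a * x) / a)) x := by
  have hl : HasDerivAt (fun x => a * x) a x := by simpa using (hasDerivAt_id x).const_mul a
  refine hl.cosh.congr_deriv ?_
  rw [← ha]
  field_simp

theorem isIVPSolution_sin {lam : ℝ} (h : 0 < lam) :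
    IsIVPSolution (fun _ => -lam) 1 (fun x => Real.sin (Real.sqrt lam * x) / Real.sqrt lam)
      (fun x => Real.cos (Real.sqrt lam * x)) :=
  IsIVPSolution.of_hasDerivAt continuousOn_const
    (fun x _ => hasDerivAt_sin_mul_div (Real.sqrt_pos.2 h).ne' x)
    (fun x _ => hasDerivAt_cos_mul (Real.mul_self_sqrt h.le) (Real.sqrt_pos.2 h).ne' x)
    (by simp) (by simp)

theorem sin_sqrt_div_sqrt_eq_zero_iff {lam : ℝ} (h : 0 < lam) :
    Real.sin (Real.sqrt lam * 1) / Real.sqrt lam = 0 ↔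
      ∃ j : ℕ, 1 ≤ j ∧ lam = (j * Real.pi) ^ 2 := by
  have hs := Real.sqrt_pos.2 h
  rw [mul_one, div_eq_zero_iff, or_iff_left hs.ne', Real.sin_eq_zero_iff]
  constructor
  · rintro ⟨k, hk⟩
    have hk0 : 0 < k := by
      by_contra! hle
      have : (k : ℝ) ≤ 0 := by exact_mod_cast hle
      nlinarith [Real.pi_pos]
    lift k to ℕ using hk0.le
    refine ⟨k, by omega, ?_⟩
    rw [← Real.sq_sqrt h.le, ← hk]
    simp
  · rintro ⟨j, -, rfl⟩
    exact ⟨j, by rw [Real.sqrt_sq (by positivity)]; simp⟩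

/-- The solutions of `-y'' = lam y`, `y(0) = 0`, `y'(0) = 1` and their Dirichlet eigenvalues. -/
theorem exists_free_solution (lam : ℝ) : ∃ y y₁ : ℝ → ℝ, (∀ x, HasDerivAt y (y₁ x) x) ∧
    (∀ x, HasDerivAt y₁ (-lam * y x) x) ∧ y 0 = 0 ∧ y₁ 0 = 1 ∧
    (y 1 = 0 ↔ ∃ j : ℕ, 1 ≤ j ∧ lam = (j * Real.pi) ^ 2) := by
  rcases lt_trichotomy lam 0 with h | rfl | h
  · have h' : 0 < -lam := neg_pos.2 h
    have hs := Real.sqrt_pos.2 h'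
    refine ⟨_, _, hasDerivAt_sinh_mul_div hs.ne',
      hasDerivAt_cosh_mul (Real.mul_self_sqrt h'.le) hs.ne', by simp, by simp, iff_of_false ?_ ?_⟩
    · rw [mul_one]
      exact div_ne_zero (Real.sinh_pos_iff.2 hs).ne' hs.ne'
    · rintro ⟨j, -, hj⟩
      nlinarith [sq_nonneg (j * Real.pi)]
  · refine ⟨fun x => x, fun _ => 1, fun x => hasDerivAt_id x,
      fun x => by simpa using hasDerivAt_const x (1 : ℝ), rfl, rfl, iff_of_false one_ne_zero ?_⟩
    rintro ⟨j, hj, h0⟩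
    have : 0 < (j * Real.pi) ^ 2 := by
      have : (0 : ℝ) < j := by exact_mod_cast hj
      have := Real.pi_pos
      positivity
    exact this.ne h0
  · have hs := Real.sqrt_pos.2 h
    exact ⟨_, _, hasDerivAt_sin_mul_div hs.ne',
      hasDerivAt_cos_mul (Real.mul_self_sqrt h.le) hs.ne', by simp, by simp,
      sin_sqrt_div_sqrt_eq_zero_iff h⟩

theorem strictMono_sq_mul_pi : StrictMono fun j : ℕ => ((j : ℝ) * Real.pi) ^ 2 := by
  intro a b hab
  have : (a : ℝ) < b := by exact_mod_cast hab
  have := Real.pi_pos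
  dsimp only
  gcongr

theorem dirichletEigenvalue_eq_of_spectrum {q : UnitL2}
    (hq : ∀ lam, IsDirichletEigenvalue q lam ↔ ∃ j : ℕ, 1 ≤ j ∧ lam = (j * Real.pi) ^ 2)
    {n : ℕ} (hn : 1 ≤ n) : dirichletEigenvalue q n = (n * Real.pi) ^ 2 := by
  refine dirichletEigenvalue_eq (μ := fun j => ((j : ℝ) * Real.pi) ^ 2) hn
    (strictMono_sq_mul_pi.strictMonoOn _) (fun j hj => (hq _).2 ⟨j, hj.1, rfl⟩) ?_
  intro lam hle hl
  obtain ⟨j, hj, rfl⟩ := (hq _).1 hl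
  exact ⟨j, ⟨hj, strictMono_sq_mul_pi.le_iff_le.1 hle⟩, rfl⟩

/-! ### Perturbation of the potential near `0` -/

instance isProbabilityMeasure_unitMeasure : IsProbabilityMeasure unitMeasure :=
  ⟨by simp [unitMeasure]⟩

theorem integral_abs_le_norm (q : UnitL2) : ∫ r in (0 : ℝ)..1, |q r| ≤ ‖q‖ := by
  have h1 : ∫ r in (0 : ℝ)..1, |q r| = (eLpNorm q 1 unitMeasure).toReal := by
    rw [intervalIntegral.integral_of_le zero_le_one, ← integral_Icc_eq_integral_Ioc,
      eLpNorm_one_eq_lintegral_enorm,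
      ← integral_norm_eq_lintegral_enorm (Lp.memLp q).aestronglyMeasurable]
    rfl
  rw [h1, Lp.norm_def]
  exact ENNReal.toReal_mono (Lp.memLp q).eLpNorm_ne_top
    (eLpNorm_le_eLpNorm_of_exponent_le (by norm_num) (Lp.memLp q).aestronglyMeasurable)

theorem integral_abs_sub_le_norm (p q : UnitL2) :
    ∫ r in (0 : ℝ)..1, |p r - q r| ≤ ‖p - q‖ := by
  refine le_of_eq_of_le ?_ (integral_abs_le_norm (p - q))
  refine intervalIntegral.integral_congr_ae ?_
  have := (ae_restrict_iff' measurableSet_Icc).1 (Lp.coeFn_sub p q)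
  filter_upwards [this] with r hr hr'
  rw [uIoc_of_le zero_le_one] at hr'
  rw [hr ⟨hr'.1.le, hr'.2⟩, Pi.sub_apply]

theorem integral_abs_potential_sub_le (p q : UnitL2) (lam μ : ℝ) :
    ∫ r in (0 : ℝ)..1, |(p r - lam) - (q r - μ)| ≤ ‖p - q‖ + |lam - μ| := by
  have h1 : (1 : ℝ) ∈ Icc (0 : ℝ) 1 := right_mem_Icc.2 zero_le_one
  have i0 : IntegrableOn (fun r => p r - q r) (Icc (0 : ℝ) 1) :=
    ((Lp.memLp p).integrable (by norm_num)).sub ((Lp.memLp q).integrable (by norm_num))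
  have i1 := (intervalIntegrable_of_mem_Icc i0 h1).abs
  have i2 := (intervalIntegrable_of_mem_Icc
    ((integrableOn_potential p lam).sub (integrableOn_potential q μ)) h1).abs
  have : ∫ r in (0 : ℝ)..1, |(p r - lam) - (q r - μ)| ≤
      ∫ r in (0 : ℝ)..1, (|p r - q r| + |lam - μ|) := by
    refine intervalIntegral.integral_mono_on zero_le_one i2
      (i1.add intervalIntegrable_const) fun r _ => ?_
    rw [show (p r - lam) - (q r - μ) = (p r - q r) - (lam - μ) by ring]
    exact abs_sub _ _
  rw [intervalIntegral.integral_add i1 intervalIntegrable_const,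
    intervalIntegral.integral_const] at this
  simp only [sub_zero, one_smul] at this
  linarith [integral_abs_sub_le_norm p q]

theorem integral_abs_potential_le (q : UnitL2) (lam : ℝ) :
    ∫ r in (0 : ℝ)..1, |q r - lam| ≤ ‖q‖ + |lam| := by
  simpa using integral_abs_potential_sub_le q 0 lam 0

/-- The solution of `-y'' + q y = lam y`, `y(0) = 0`, `y'(0) = 1`. -/
def fundSol (q : UnitL2) (lam : ℝ) : ℝ → ℝ :=
  (exists_isIVPSolution (integrableOn_potential q lam)).choose

/-- The derivative of `fundSol q lam`. -/
def fundSolDeriv (q : UnitL2) (lam : ℝ) : ℝ → ℝ :=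
  (exists_isIVPSolution (integrableOn_potential q lam)).choose_spec.choose

theorem fundSol_spec (q : UnitL2) (lam : ℝ) :
    IsIVPSolution (fun x => q x - lam) 1 (fundSol q lam) (fundSolDeriv q lam) :=
  (exists_isIVPSolution (integrableOn_potential q lam)).choose_spec.choose_spec

theorem isDirichletEigenvalue_iff_fundSol {q : UnitL2} {lam : ℝ} :
    IsDirichletEigenvalue q lam ↔ fundSol q lam 1 = 0 :=
  isDirichletEigenvalue_iff (fundSol_spec q lam)

theorem abs_fundSol_le {q : UnitL2} {lam R : ℝ} (h : ‖q‖ + |lam| ≤ R) {x : ℝ}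
    (hx : x ∈ Icc (0 : ℝ) 1) :
    |fundSol q lam x| ≤ growthConst R ∧ |fundSolDeriv q lam x| ≤ growthConst R := by
  simpa using (fundSol_spec q lam).abs_le (integrableOn_potential q lam)
    ((integral_abs_potential_le q lam).trans h) x hx

theorem abs_fundSol_sub_le {p q : UnitL2} {lam μ R : ℝ} (h : ‖p‖ + |lam| ≤ R)
    (h' : ‖q‖ + |μ| ≤ R) {x : ℝ} (hx : x ∈ Icc (0 : ℝ) 1) :
    |fundSol p lam x - fundSol q μ x| ≤ growthConst R ^ 2 * (‖p - q‖ + |lam - μ|) ∧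
      |fundSolDeriv p lam x - fundSolDeriv q μ x| ≤
        growthConst R ^ 2 * (‖p - q‖ + |lam - μ|) :=
  (fundSol_spec p lam).abs_sub_le (fundSol_spec q μ) (integrableOn_potential p lam)
    (integrableOn_potential q μ) ((integral_abs_potential_le p lam).trans h)
    ((integral_abs_potential_le q μ).trans h') (integral_abs_potential_sub_le p q lam μ) x hx

theorem continuous_fundSol {x : ℝ} (hx : x ∈ Icc (0 : ℝ) 1) :
    Continuous fun p : UnitL2 × ℝ => fundSol p.1 p.2 x := by
  rw [continuous_iff_continuousAt]
  rintro ⟨q, lam⟩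
  set R := ‖q‖ + |lam| + 1
  have hnear : ∀ᶠ p : UnitL2 × ℝ in 𝓝 (q, lam), ‖p.1‖ + |p.2| ≤ R :=
    ((by fun_prop : Continuous fun p : UnitL2 × ℝ => ‖p.1‖ + |p.2|).tendsto
      (q, lam)).eventually_le_const (by simp [R])
  have hlim : Tendsto (fun p : UnitL2 × ℝ => growthConst R ^ 2 * (‖p.1 - q‖ + |p.2 - lam|))
      (𝓝 (q, lam)) (𝓝 0) := by
    have := (by fun_prop : Continuous fun p : UnitL2 × ℝ =>
      growthConst R ^ 2 * (‖p.1 - q‖ + |p.2 - lam|)).tendsto (q, lam)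
    simpa using this
  refine tendsto_iff_norm_sub_tendsto_zero.2 (squeeze_zero' (Eventually.of_forall fun _ =>
    norm_nonneg _) ?_ hlim)
  filter_upwards [hnear] with p hp
  exact (abs_fundSol_sub_le hp (by simp [R]) hx).1

theorem potential_zero_ae_eq (lam : ℝ) :
    (fun x => (0 : UnitL2) x - lam) =ᵐ[unitMeasure] fun _ => -lam :=
  Eventually.of_forall fun x => by simp

theorem isDirichletEigenvalue_zero_iff {lam : ℝ} :
    IsDirichletEigenvalue 0 lam ↔ ∃ j : ℕ, 1 ≤ j ∧ lam = (j * Real.pi) ^ 2 := by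
  obtain ⟨y, y₁, hy, hy₁, h0, h1, hiff⟩ := exists_free_solution lam
  have h : IsIVPSolution (fun _ => -lam) 1 y y₁ := IsIVPSolution.of_hasDerivAt continuousOn_const
    (fun x _ => hy x) (fun x _ => hy₁ x) h0 h1
  rw [isDirichletEigenvalue_iff (h.congr (potential_zero_ae_eq lam).symm), hiff]

theorem fundSol_zero_eqOn {lam : ℝ} (h : 0 < lam) :
    EqOn (fundSol 0 lam) (fun x => Real.sin (Real.sqrt lam * x) / Real.sqrt lam)
      (Icc (0 : ℝ) 1) :=
  ((fundSol_spec 0 lam).eqOn ((isIVPSolution_sin h).congr (potential_zero_ae_eq lam).symm)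
    (integrableOn_potential 0 lam)).1

/-- Potentials of norm less than one have only positive Dirichlet eigenvalues. -/
theorem IsDirichletEigenvalue.pos {q : UnitL2} {lam : ℝ} (h : IsDirichletEigenvalue q lam)
    (hq : ‖q‖ < 1) : 0 < lam := by
  by_contra! hlam
  have h01 : (1 : ℝ) ∈ Icc (0 : ℝ) 1 := right_mem_Icc.2 zero_le_one
  have hs := fundSol_spec q lam
  have h1 := isDirichletEigenvalue_iff_fundSol.1 h
  set y := fundSol q lam
  set y₁ := fundSolDeriv q lam
  have hV := integrableOn_potential q lam
  have cy := hs.continuousOn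
  have cy₁ := hs.continuousOn_deriv hV
  have iV := integrableOn_mul_of_continuousOn hV cy
  have ibp := integral_mul_add_mul_of_primitive iV cy₁.integrableOn_Icc
    (F := y₁) (G := y) (fun x hx => by rw [hs.deriv_zero, hs.deriv_eq x hx])
    (fun x hx => by rw [hs.zero, zero_add, hs.eq x hx])
  rw [h1, hs.zero, mul_zero, mul_zero, sub_zero] at ibp
  -- Energy argument: `ibp` says ∫(q - lam)y² + ∫y'² = 0. With a = ∫|y'| one has |y| ≤ a and a² ≤
  -- ∫y'², so lam ≤ 0 forces a² ≤ ‖q‖a², hence a = 0.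
  set a := ∫ x in (0 : ℝ)..1, |y₁ x| with ha
  have ia : IntervalIntegrable (fun x => |y₁ x|) volume 0 1 :=
    intervalIntegrable_of_mem_Icc cy₁.abs.integrableOn_Icc h01
  have ia2 : IntervalIntegrable (fun x => y₁ x * y₁ x) volume 0 1 :=
    intervalIntegrable_of_mem_Icc (cy₁.mul cy₁).integrableOn_Icc h01
  have hya : ∀ x ∈ Icc (0 : ℝ) 1, |y x| ≤ a := by
    intro x hx
    rw [hs.eq x hx]
    exact (intervalIntegral.abs_integral_le_integral_abs hx.1).trans
      (intervalIntegral.integral_mono_interval le_rfl hx.1 hx.2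
        (Eventually.of_forall fun r => abs_nonneg _) ia)
  have ha0 : 0 ≤ a := (abs_nonneg _).trans (hya 1 h01)
  have hCS : a ^ 2 ≤ ∫ x in (0 : ℝ)..1, y₁ x * y₁ x := by
    have h2 : 0 ≤ ∫ x in (0 : ℝ)..1, ((y₁ x * y₁ x - 2 * a * |y₁ x|) + a ^ 2) := by
      refine intervalIntegral.integral_nonneg zero_le_one fun x _ => ?_
      nlinarith [sq_nonneg (|y₁ x| - a), abs_mul_abs_self (y₁ x)]
    rw [intervalIntegral.integral_add (ia2.sub (ia.const_mul _))
      intervalIntegrable_const, intervalIntegral.integral_sub ia2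
      (ia.const_mul _), intervalIntegral.integral_const_mul, intervalIntegral.integral_const,
      ← ha] at h2
    simp only [sub_zero, one_smul] at h2
    linarith
  have iq : IntegrableOn q (Icc (0 : ℝ) 1) := (Lp.memLp q).integrable (by norm_num)
  have hqy : |∫ x in (0 : ℝ)..1, q x * (y x * y x)| ≤ ‖q‖ * a ^ 2 := by
    refine abs_integral_mul_le_of_abs_le iq (integral_abs_le_norm q) (sq_nonneg a) h01
      fun r hr => ?_
    rw [abs_mul, ← sq]
    exact pow_le_pow_left₀ (abs_nonneg _) (hya r hr) 2
  have iqy := intervalIntegrable_of_mem_Icc (integrableOn_mul_of_continuousOn iq (cy.mul cy)) h01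
  have iy2 : IntervalIntegrable (fun x => y x * y x) volume 0 1 :=
    intervalIntegrable_of_mem_Icc (cy.mul cy).integrableOn_Icc h01
  simp only [Pi.mul_apply] at iqy
  have split : ∫ x in (0 : ℝ)..1, ((q x - lam) * y x * y x + y₁ x * y₁ x) =
      (∫ x in (0 : ℝ)..1, q x * (y x * y x)) - lam * (∫ x in (0 : ℝ)..1, y x * y x) +
        ∫ x in (0 : ℝ)..1, y₁ x * y₁ x := by
    rw [← intervalIntegral.integral_const_mul, ← intervalIntegral.integral_sub iqy
      (iy2.const_mul _), ← intervalIntegral.integral_add (iqy.sub (iy2.const_mul _)) ia2]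
    congr 1
    ext x
    ring
  rw [split] at ibp
  have hy2 : 0 ≤ ∫ x in (0 : ℝ)..1, y x * y x :=
    intervalIntegral.integral_nonneg zero_le_one fun x _ => mul_self_nonneg _
  have hA : a ^ 2 ≤ ‖q‖ * a ^ 2 := by
    nlinarith [neg_abs_le (∫ x in (0 : ℝ)..1, q x * (y x * y x)), mul_nonneg (neg_nonneg.2 hlam) hy2]
  have ha00 : a = 0 := by
    by_contra hne
    have : 0 < a ^ 2 := by positivity
    nlinarith
  obtain ⟨x, hx, hne⟩ := hs.exists_ne_zero
  exact hne (abs_nonpos_iff.1 ((hya x hx).trans_eq ha00))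

/-! ### Location of the eigenvalues of small potentials -/

/-- The gap 2 makes windows of radius at most 1 around the free eigenvalues disjoint. -/
theorem sq_mul_pi_add_two_lt {i j : ℕ} (hij : i < j) :
    ((i : ℝ) * Real.pi) ^ 2 + 2 < ((j : ℝ) * Real.pi) ^ 2 := by
  have h1 : (i : ℝ) + 1 ≤ j := by exact_mod_cast hij
  have h2 := Real.pi_gt_three
  have h3 : (0 : ℝ) ≤ i := Nat.cast_nonneg i
  have h4 : (i * Real.pi) + 3 ≤ j * Real.pi := by nlinarith
  have h5 : 0 ≤ (i : ℝ) * Real.pi := by positivity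
  nlinarith

theorem one_lt_sq_mul_pi {j : ℕ} (hj : 1 ≤ j) : 2 < ((j : ℝ) * Real.pi) ^ 2 := by
  simpa using sq_mul_pi_add_two_lt (i := 0) hj

/-- Small potentials have eigenvalues only near those of the zero potential. -/
theorem eventually_exists_abs_sub_lt (n : ℕ) {δ : ℝ} (hδ : 0 < δ) :
    ∀ᶠ q : UnitL2 in 𝓝 0, ∀ lam ≤ ((n : ℝ) * Real.pi) ^ 2 + 1, IsDirichletEigenvalue q lam →
      ∃ j : ℕ, 1 ≤ j ∧ |lam - (j * Real.pi) ^ 2| < δ := by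
  set Λ := ((n : ℝ) * Real.pi) ^ 2 + 1 with hΛ
  -- On the compact set `K` the shooting function of the zero potential has no zero, and the tube
  -- lemma extends this to small `q`. Positivity of the eigenvalues allows `K` to start at 0.
  set K : Set ℝ := Icc 0 Λ ∩ ⋂ j : ℕ, ⋂ _ : 1 ≤ j, {lam | δ ≤ |lam - (j * Real.pi) ^ 2|} with hK
  have hKc : IsCompact K := isCompact_Icc.inter_right
    (isClosed_iInter fun j => isClosed_iInter fun _ => isClosed_le continuous_const (by fun_prop))
  have h01 : (1 : ℝ) ∈ Icc (0 : ℝ) 1 := right_mem_Icc.2 zero_le_one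
  have hopen : IsOpen {p : UnitL2 × ℝ | fundSol p.1 p.2 1 ≠ 0} :=
    isOpen_ne_fun (continuous_fundSol h01) continuous_const
  have hsub : ({(0 : UnitL2)} : Set UnitL2) ×ˢ K ⊆ {p : UnitL2 × ℝ | fundSol p.1 p.2 1 ≠ 0} := by
    rintro ⟨q, lam⟩ ⟨hq, hlam⟩ h0
    rw [mem_singleton_iff] at hq
    dsimp only at hq h0 hlam
    subst hq
    obtain ⟨j, hj, rfl⟩ := isDirichletEigenvalue_zero_iff.1
      (isDirichletEigenvalue_iff_fundSol.2 h0)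
    have := mem_iInter₂.1 hlam.2 j hj
    simp only [mem_ofPred_eq, sub_self, abs_zero] at this
    linarith
  obtain ⟨u, v, hu, -, h0u, hKv, huv⟩ :=
    generalized_tube_lemma isCompact_singleton hKc hopen hsub
  filter_upwards [hu.mem_nhds (h0u rfl), Metric.ball_mem_nhds (0 : UnitL2) one_pos]
    with q hq hq1 lam hlam hev
  by_contra! hcon
  have hpos := hev.pos (mem_ball_zero_iff.1 hq1)
  have hmem : lam ∈ K := ⟨⟨hpos.le, hlam⟩, mem_iInter₂.2 fun j hj => hcon j hj⟩
  exact huv (mk_mem_prod hq (hKv hmem)) (isDirichletEigenvalue_iff_fundSol.1 hev)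

/-- The shooting function is sin(√λ)/√λ, and the two roots lie on either side of jπ at distance less
than π. The sign change survives small perturbations and feeds the intermediate value theorem. -/
theorem fundSol_zero_mul_neg {j : ℕ} (hj : 1 ≤ j) {δ : ℝ} (hδ : 0 < δ) (hδ1 : δ ≤ 1) :
    fundSol 0 ((j * Real.pi) ^ 2 - δ) 1 * fundSol 0 ((j * Real.pi) ^ 2 + δ) 1 < 0 := by
  have h01 : (1 : ℝ) ∈ Icc (0 : ℝ) 1 := right_mem_Icc.2 zero_le_one
  have hj2 := one_lt_sq_mul_pi hj
  have hp := Real.pi_pos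
  have ha : 0 < (j * Real.pi) ^ 2 - δ := by linarith
  have hb : 0 < (j * Real.pi) ^ 2 + δ := by linarith
  rw [fundSol_zero_eqOn ha h01, fundSol_zero_eqOn hb h01]
  simp only [mul_one]
  have hsa := Real.sqrt_pos.2 ha
  have hsb := Real.sqrt_pos.2 hb
  set a := Real.sqrt ((j * Real.pi) ^ 2 - δ)
  set b := Real.sqrt ((j * Real.pi) ^ 2 + δ)
  have hjp : 0 < j * Real.pi := by
    have : (0 : ℝ) < j := by exact_mod_cast hj
    positivity
  have ha1 : a < j * Real.pi := by
    rw [Real.sqrt_lt' hjp]; linarith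
  have hb1 : j * Real.pi < b := Real.lt_sqrt_of_sq_lt (by linarith)
  have ha2 : ((j - 1 : ℕ) : ℝ) * Real.pi < a := by
    refine Real.lt_sqrt_of_sq_lt ?_
    linarith [sq_mul_pi_add_two_lt (Nat.sub_lt hj one_pos)]
  have hb2 : b < ((j + 1 : ℕ) : ℝ) * Real.pi := by
    rw [Real.sqrt_lt' (by positivity)]
    linarith [sq_mul_pi_add_two_lt (Nat.lt_succ_self j)]
  rw [Nat.cast_sub hj, Nat.cast_one] at ha2
  rw [Nat.cast_add, Nat.cast_one] at hb2
  have s1 : Real.sin (a - j * Real.pi) < 0 :=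
    Real.sin_neg_of_neg_of_neg_pi_lt (by linarith) (by linarith)
  have s2 : 0 < Real.sin (b - j * Real.pi) := Real.sin_pos_of_pos_of_lt_pi (by linarith) (by linarith)
  have s3 : Real.sin a * Real.sin b = Real.sin (a - j * Real.pi) * Real.sin (b - j * Real.pi) := by
    rw [Real.sin_sub_nat_mul_pi, Real.sin_sub_nat_mul_pi, mul_mul_mul_comm, ← mul_pow]
    simp
  rw [div_mul_div_comm, s3]
  exact div_neg_of_neg_of_pos (mul_neg_of_neg_of_pos s1 s2) (mul_pos hsa hsb)

/-- Small potentials have an eigenvalue near each eigenvalue of the zero potential. -/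
theorem eventually_exists_isDirichletEigenvalue {j : ℕ} (hj : 1 ≤ j) {δ : ℝ} (hδ : 0 < δ)
    (hδ1 : δ ≤ 1) : ∀ᶠ q : UnitL2 in 𝓝 0,
      ∃ lam, |lam - (j * Real.pi) ^ 2| ≤ δ ∧ IsDirichletEigenvalue q lam := by
  have h01 : (1 : ℝ) ∈ Icc (0 : ℝ) 1 := right_mem_Icc.2 zero_le_one
  have hc : ∀ lam : ℝ, Continuous fun q : UnitL2 => fundSol q lam 1 := fun lam =>
    (continuous_fundSol h01).comp (continuous_id.prodMk continuous_const)
  have hev := (((hc ((j * Real.pi) ^ 2 - δ)).mul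
    (hc ((j * Real.pi) ^ 2 + δ))).tendsto 0).eventually_lt_const (fundSol_zero_mul_neg hj hδ hδ1)
  filter_upwards [hev] with q hq
  have hcl : ContinuousOn (fun lam => fundSol q lam 1)
      (uIcc ((j * Real.pi) ^ 2 - δ) ((j * Real.pi) ^ 2 + δ)) :=
    ((continuous_fundSol h01).comp (continuous_const.prodMk continuous_id)).continuousOn
  have h0 : (0 : ℝ) ∈ uIcc (fundSol q ((j * Real.pi) ^ 2 - δ) 1)
      (fundSol q ((j * Real.pi) ^ 2 + δ) 1) := by
    rw [mem_uIcc]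
    rcases mul_neg_iff.1 hq with h | h
    · exact Or.inr ⟨h.2.le, h.1.le⟩
    · exact Or.inl ⟨h.1.le, h.2.le⟩
  obtain ⟨lam, hlam, hz⟩ := intermediate_value_uIcc hcl h0
  rw [uIcc_of_le (by linarith)] at hlam
  exact ⟨lam, abs_le.2 ⟨by linarith [hlam.1], by linarith [hlam.2]⟩,
    isDirichletEigenvalue_iff_fundSol.2 hz⟩

/-- Near `(0, (jπ)²)` the fundamental solutions have uniformly positive inner products. -/
theorem exists_le_integral_fundSol_mul (μ : ℝ) : ∃ δ > 0, ∃ c > 0,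
    ∀ p q : UnitL2, ∀ lam ν : ℝ, ‖p‖ < δ → ‖q‖ < δ → |lam - μ| < δ → |ν - μ| < δ →
      c ≤ ∫ x in (0 : ℝ)..1, fundSol p lam x * fundSol q ν x := by
  have h01 : (1 : ℝ) ∈ Icc (0 : ℝ) 1 := right_mem_Icc.2 zero_le_one
  set c := (∫ x in (0 : ℝ)..1, fundSol 0 μ x ^ 2) / 2 with hc
  have hc0 : 0 < c := half_pos (fundSol_spec 0 μ).integral_sq_pos
  set R := |μ| + 2 with hR
  have hG := growthConst_pos (R := R) (by positivity)
  set G := growthConst R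
  -- The free solution has squared norm 2c. Replacing either factor costs at most G · G² · c/(2G³) =
  -- c/2 pointwise, so at least c remains.
  refine ⟨min 1 (c / (4 * G ^ 3)), by positivity, c, hc0, ?_⟩
  intro p q lam ν hp hq hlam hν
  have key : ∀ (q : UnitL2) (ν : ℝ), ‖q‖ < min 1 (c / (4 * G ^ 3)) →
      |ν - μ| < min 1 (c / (4 * G ^ 3)) → ‖q‖ + |ν| ≤ R ∧ ‖q - 0‖ + |ν - μ| ≤ c / (2 * G ^ 3) := by
    intro q ν h1 h2
    constructor
    · have := abs_sub_abs_le_abs_sub ν μ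
      linarith [h1.trans_le (min_le_left _ _), h2.trans_le (min_le_left _ _)]
    · rw [sub_zero, show c / (2 * G ^ 3) = c / (4 * G ^ 3) + c / (4 * G ^ 3) by field_simp; norm_num]
      exact add_le_add (h1.trans_le (min_le_right _ _)).le (h2.trans_le (min_le_right _ _)).le
  obtain ⟨hpR, hpd⟩ := key p lam hp hlam
  obtain ⟨hqR, hqd⟩ := key q ν hq hν
  have h0R : ‖(0 : UnitL2)‖ + |μ| ≤ R := by simp [hR]
  have e : G * (G ^ 2 * (c / (2 * G ^ 3))) = c / 2 := by field_simp
  have hpt : ∀ x ∈ Icc (0 : ℝ) 1,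
      fundSol 0 μ x ^ 2 - c ≤ fundSol p lam x * fundSol q ν x := by
    intro x hx
    have b1 := (abs_fundSol_le hpR hx).1
    have b2 := (abs_fundSol_le h0R hx).1
    have d1 := (abs_fundSol_sub_le hpR h0R hx).1.trans
      (mul_le_mul_of_nonneg_left hpd (sq_nonneg G))
    have d2 := (abs_fundSol_sub_le hqR h0R hx).1.trans
      (mul_le_mul_of_nonneg_left hqd (sq_nonneg G))
    have m1 : |fundSol p lam x * (fundSol q ν x - fundSol 0 μ x)| ≤ c / 2 := by
      rw [abs_mul, ← e]
      exact mul_le_mul b1 d2 (abs_nonneg _) hG.le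
    have m2 : |fundSol 0 μ x * (fundSol p lam x - fundSol 0 μ x)| ≤ c / 2 := by
      rw [abs_mul, ← e]
      exact mul_le_mul b2 d1 (abs_nonneg _) hG.le
    nlinarith [neg_le_of_abs_le m1, neg_le_of_abs_le m2]
  have cp := (fundSol_spec p lam).continuousOn
  have cq := (fundSol_spec q ν).continuousOn
  have c0 := (fundSol_spec 0 μ).continuousOn
  have i0 : IntervalIntegrable (fun x => fundSol 0 μ x ^ 2) volume 0 1 :=
    intervalIntegrable_of_mem_Icc (c0.pow 2).integrableOn_Icc h01
  have hint := intervalIntegral.integral_mono_on zero_le_one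
    (i0.sub intervalIntegrable_const)
    (intervalIntegrable_of_mem_Icc (cp.mul cq).integrableOn_Icc h01) hpt
  rw [intervalIntegral.integral_sub i0 intervalIntegrable_const,
    intervalIntegral.integral_const] at hint
  simp only [sub_zero, one_smul, Pi.mul_apply] at hint
  linarith

/-- The Wronskian identity reads (lam - ν)∫yz = ∫(p - q)yz. With ∫yz bounded below, it yields local
uniqueness of eigenvalues (p = q) and their Lipschitz dependence on the potential. -/
theorem abs_sub_mul_integral_le {p q : UnitL2} {lam ν R : ℝ} (hp : IsDirichletEigenvalue p lam)
    (hq : IsDirichletEigenvalue q ν) (hpR : ‖p‖ + |lam| ≤ R) (hqR : ‖q‖ + |ν| ≤ R) :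
    |(lam - ν) * ∫ x in (0 : ℝ)..1, fundSol p lam x * fundSol q ν x| ≤
      ‖p - q‖ * growthConst R ^ 2 := by
  have h01 : (1 : ℝ) ∈ Icc (0 : ℝ) 1 := right_mem_Icc.2 zero_le_one
  have W := (fundSol_spec p lam).integral_sub_mul_mul_eq_zero (fundSol_spec q ν)
    (integrableOn_potential p lam) (integrableOn_potential q ν)
    (isDirichletEigenvalue_iff_fundSol.1 hp) (isDirichletEigenvalue_iff_fundSol.1 hq)
  have cm := (fundSol_spec p lam).continuousOn.mul (fundSol_spec q ν).continuousOn
  have ipq : IntegrableOn (fun x => p x - q x) (Icc (0 : ℝ) 1) :=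
    ((Lp.memLp p).integrable (by norm_num)).sub ((Lp.memLp q).integrable (by norm_num))
  have i1 := intervalIntegrable_of_mem_Icc (integrableOn_mul_of_continuousOn ipq cm) h01
  have i2 : IntervalIntegrable (fun x => fundSol p lam x * fundSol q ν x) volume 0 1 :=
    intervalIntegrable_of_mem_Icc cm.integrableOn_Icc h01
  simp only [Pi.mul_apply] at i1
  have e : (lam - ν) * ∫ x in (0 : ℝ)..1, fundSol p lam x * fundSol q ν x =
      ∫ x in (0 : ℝ)..1, (p x - q x) * (fundSol p lam x * fundSol q ν x) := by
    rw [← intervalIntegral.integral_const_mul, ← sub_eq_zero, ← neg_eq_zero, neg_sub,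
      ← intervalIntegral.integral_sub i1 (i2.const_mul _), ← W]
    congr 1
    ext x
    ring
  rw [e]
  refine abs_integral_mul_le_of_abs_le ipq (integral_abs_sub_le_norm p q) (sq_nonneg _) h01
    fun r hr => ?_
  rw [abs_mul, sq]
  exact mul_le_mul (abs_fundSol_le hpR hr).1 (abs_fundSol_le hqR hr).1 (abs_nonneg _)
    ((abs_nonneg _).trans (abs_fundSol_le hpR hr).1)

theorem exists_eigenvalue_unique (μ : ℝ) : ∃ δ > 0, ∀ q : UnitL2, ‖q‖ < δ → ∀ lam ν : ℝ,
    |lam - μ| < δ → |ν - μ| < δ → IsDirichletEigenvalue q lam → IsDirichletEigenvalue q ν →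
      lam = ν := by
  obtain ⟨δ, hδ, c, hc, h⟩ := exists_le_integral_fundSol_mul μ
  refine ⟨δ, hδ, fun q hq lam ν hlam hν h1 h2 => ?_⟩
  have hc' := h q q lam ν hq hq hlam hν
  have := abs_sub_mul_integral_le h1 h2 (le_max_left _ _) (le_max_right _ _)
  rw [sub_self, norm_zero, zero_mul, abs_nonpos_iff, mul_eq_zero, sub_eq_zero] at this
  exact this.resolve_right (hc.trans_le hc').ne'

/-- The `n`-th eigenvalue is continuous at the zero potential. -/
theorem eventually_dirichletEigenvalue {n : ℕ} (hn : 1 ≤ n) {δ : ℝ} (hδ : 0 < δ) :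
    ∀ᶠ q : UnitL2 in 𝓝 0, IsDirichletEigenvalue q (dirichletEigenvalue q n) ∧
      |dirichletEigenvalue q n - (n * Real.pi) ^ 2| < δ := by
  choose d hd huniq using fun j : ℕ => exists_eigenvalue_unique ((j * Real.pi) ^ 2)
  -- Below 1 the windows are disjoint, and below `d j` each of the first `n` contains at most one
  -- eigenvalue. The μ j found below are then all the eigenvalues up to μ n.
  obtain ⟨η, hη, hη1, hηδ, hηd⟩ : ∃ η > 0, η < 1 ∧ η < δ ∧ ∀ j ∈ Finset.Icc 1 n, η < d j := by
    have hmem : ∀ᶠ η in 𝓝[>] (0 : ℝ), η < 1 ∧ η < δ ∧ ∀ j ∈ Finset.Icc 1 n, η < d j := by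
      refine (eventually_nhdsWithin_of_eventually_nhds ((eventually_lt_nhds one_pos).and
        ((eventually_lt_nhds hδ).and ?_)))
      exact (Filter.eventually_all_finset _).2 fun j _ => eventually_lt_nhds (hd j)
    obtain ⟨η, h, hη⟩ := (hmem.and self_mem_nhdsWithin).exists
    exact ⟨η, hη, h⟩
  have hex : ∀ᶠ q : UnitL2 in 𝓝 0, ∀ j ∈ Finset.Icc 1 n, ∃ lam, |lam - (j * Real.pi) ^ 2| ≤ η ∧
      IsDirichletEigenvalue q lam :=
    (Filter.eventually_all_finset _).2 fun j hj =>
      eventually_exists_isDirichletEigenvalue (Finset.mem_Icc.1 hj).1 hη hη1.le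
  have hsmall : ∀ᶠ q : UnitL2 in 𝓝 0, ‖q‖ < η := by
    filter_upwards [Metric.ball_mem_nhds (0 : UnitL2) hη] with q hq using mem_ball_zero_iff.1 hq
  filter_upwards [hex, hsmall, eventually_exists_abs_sub_lt n hη] with q hq hqη hnear
  choose! μ hμ hev using hq
  have hsep : ∀ j ∈ Icc 1 n, |μ j - (j * Real.pi) ^ 2| ≤ η := fun j hj =>
    hμ j (Finset.mem_Icc.2 hj)
  have hnn : n ∈ Icc 1 n := ⟨hn, le_rfl⟩
  have heq : dirichletEigenvalue q n = μ n := by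
    refine dirichletEigenvalue_eq hn ?_ (fun j hj => hev j (Finset.mem_Icc.2 hj)) ?_
    · intro i hi j hj hij
      have h1 := abs_le.1 (hsep i hi)
      have h2 := abs_le.1 (hsep j hj)
      linarith [sq_mul_pi_add_two_lt hij, h1.2, h2.1]
    · intro lam hlam hl
      have hle : lam ≤ (n * Real.pi) ^ 2 + 1 := by linarith [(abs_le.1 (hsep n hnn)).2]
      obtain ⟨j, hj, hjd⟩ := hnear lam hle hl
      have hjn : j ≤ n := by
        by_contra! hlt
        linarith [sq_mul_pi_add_two_lt hlt, (abs_lt.1 hjd).1]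
      have hjm : j ∈ Finset.Icc 1 n := Finset.mem_Icc.2 ⟨hj, hjn⟩
      have hdj := hηd j hjm
      exact ⟨j, ⟨hj, hjn⟩, huniq j q (hqη.trans hdj) lam (μ j) (hjd.trans hdj)
        ((hsep j ⟨hj, hjn⟩).trans_lt hdj) hl (hev j hjm)⟩
  rw [heq]
  exact ⟨hev n (Finset.mem_Icc.2 hnn), (hsep n hnn).trans_lt hηδ⟩

/-! ### Local Lipschitz continuity of the vector field at `0` -/

theorem norm_le_of_ae_abs_le {f : UnitL2} {C : ℝ} (hC : 0 ≤ C)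
    (h : ∀ᵐ x ∂unitMeasure, |f x| ≤ C) : ‖f‖ ≤ C := by
  simpa [measureUnivNNReal] using Lp.norm_le_of_ae_bound (f := f) hC h

theorem abs_mul_sub_mul_le {a b a' b' G η : ℝ} (ha : |a| ≤ G) (hb' : |b'| ≤ G)
    (h : |a - a'| ≤ η) (h' : |b - b'| ≤ η) : |a * b - a' * b'| ≤ 2 * G * η := by
  have hG := (abs_nonneg _).trans ha
  have h1 : |a * (b - b')| ≤ G * η := by
    rw [abs_mul]; exact mul_le_mul ha h' (abs_nonneg _) hG
  have h2 : |(a - a') * b'| ≤ η * G := by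
    rw [abs_mul]; exact mul_le_mul h hb' (abs_nonneg _) ((abs_nonneg _).trans h)
  calc |a * b - a' * b'| = |a * (b - b') + (a - a') * b'| := by ring_nf
    _ ≤ _ := abs_add_le _ _
    _ ≤ 2 * G * η := by linarith

theorem abs_div_sub_div_le {a a' N N' B c κ : ℝ} (hc : 0 < c) (hN : c ≤ N) (hN' : c ≤ N')
    (ha' : |a'| ≤ B) (h : |a - a'| ≤ κ) (h' : |N - N'| ≤ κ) :
    |a / N - a' / N'| ≤ (1 / c + B / c ^ 2) * κ := by
  have hN0 := hc.trans_le hN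
  have hN0' := hc.trans_le hN'
  have hκ := (abs_nonneg _).trans h
  have hB := (abs_nonneg _).trans ha'
  have h1 : |(a - a') / N| ≤ κ / c := by
    rw [abs_div, abs_of_pos hN0]
    exact div_le_div₀ hκ h hc hN
  have h2 : |a' * (N' - N) / (N * N')| ≤ B * κ / c ^ 2 := by
    rw [abs_div, abs_of_pos (mul_pos hN0 hN0'), abs_mul, abs_sub_comm N' N, sq]
    exact div_le_div₀ (by positivity) (mul_le_mul ha' h' (abs_nonneg _) hB) (by positivity)
      (mul_le_mul hN hN' hc.le hN0.le)
  calc |a / N - a' / N'| = |(a - a') / N + a' * (N' - N) / (N * N')| := by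
        congr 1; field_simp; ring
    _ ≤ _ := abs_add_le _ _
    _ ≤ κ / c + B * κ / c ^ 2 := add_le_add h1 h2
    _ = _ := by ring

/-- The field equals 4yy'/∫y² for the fundamental solution at the n-th eigenvalue. Here y and y' are
Lipschitz in potential and eigenvalue, the eigenvalue is Lipschitz by the Wronskian identity, and
∫y² is bounded below. -/
theorem exists_lipschitzOnWith_vectorField {n : ℕ} (hn : 1 ≤ n) :
    ∃ s ∈ 𝓝 (0 : UnitL2), ∃ K, LipschitzOnWith K (vectorField n) s := by
  have h01 : (1 : ℝ) ∈ Icc (0 : ℝ) 1 := right_mem_Icc.2 zero_le_one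
  obtain ⟨δ, hδ, c, hc, hover⟩ := exists_le_integral_fundSol_mul ((n * Real.pi) ^ 2)
  set R := (n * Real.pi) ^ 2 + 2 * δ with hR
  have hG := growthConst_pos (R := R) (by positivity)
  set G := growthConst R with hGdef
  -- G²/c is the Lipschitz constant of the eigenvalue, and `L` that of y and y' along it; `C` then
  -- comes from the product and quotient estimates.
  set L := G ^ 2 * (1 + G ^ 2 / c) with hL
  set C := 4 * ((1 / c + G * G / c ^ 2) * (2 * G * L)) with hC
  have hC0 : 0 ≤ C := by positivity
  refine ⟨{q : UnitL2 | ‖q‖ < δ ∧ IsDirichletEigenvalue q (dirichletEigenvalue q n) ∧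
      |dirichletEigenvalue q n - (n * Real.pi) ^ 2| < δ}, ?_, C.toNNReal, ?_⟩
  · have hsmall : ∀ᶠ q : UnitL2 in 𝓝 0, ‖q‖ < δ := by
      filter_upwards [Metric.ball_mem_nhds (0 : UnitL2) hδ] with q hq using mem_ball_zero_iff.1 hq
    exact hsmall.and (eventually_dirichletEigenvalue hn hδ)
  refine LipschitzOnWith.of_dist_le_mul fun p hp q hq => ?_
  rw [Real.coe_toNNReal C hC0, dist_eq_norm, dist_eq_norm]
  obtain ⟨hp1, hp2, hp3⟩ := hp
  obtain ⟨hq1, hq2, hq3⟩ := hq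
  have bound : ∀ {q : UnitL2} {ν : ℝ}, ‖q‖ < δ → |ν - (n * Real.pi) ^ 2| < δ → ‖q‖ + |ν| ≤ R := by
    intro q ν h1 h2
    have := abs_sub_abs_le_abs_sub ν ((n * Real.pi) ^ 2)
    rw [abs_of_nonneg (sq_nonneg (n * Real.pi))] at this
    linarith
  have hpR := bound hp1 hp3
  have hqR := bound hq1 hq3
  have hop := hover p p _ _ hp1 hp1 hp3 hp3
  have hoq := hover q q _ _ hq1 hq1 hq3 hq3
  have hpq := hover p q _ _ hp1 hq1 hp3 hq3
  have hW := abs_sub_mul_integral_le hp2 hq2 hpR hqR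
  have sp := fundSol_spec p (dirichletEigenvalue p n)
  have sq' := fundSol_spec q (dirichletEigenvalue q n)
  have fp := vectorField_ae_eq sp (isDirichletEigenvalue_iff_fundSol.1 hp2)
  have fq := vectorField_ae_eq sq' (isDirichletEigenvalue_iff_fundSol.1 hq2)
  set lam := dirichletEigenvalue p n
  set ν := dirichletEigenvalue q n
  set d := ‖p - q‖ with hd
  have hd0 : 0 ≤ d := norm_nonneg _
  have hlam : |lam - ν| ≤ G ^ 2 / c * d := by
    rw [abs_mul, abs_of_pos (hc.trans_le hpq)] at hW
    rw [div_mul_eq_mul_div, le_div_iff₀ hc]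
    nlinarith [mul_le_mul_of_nonneg_left hpq (abs_nonneg (lam - ν))]
  have hη : G ^ 2 * (d + |lam - ν|) ≤ L * d := by
    rw [hL, mul_assoc]
    gcongr
    linarith
  have hy : ∀ x ∈ Icc (0 : ℝ) 1, |fundSol p lam x - fundSol q ν x| ≤ L * d := fun x hx =>
    (abs_fundSol_sub_le hpR hqR hx).1.trans hη
  have hy₁ : ∀ x ∈ Icc (0 : ℝ) 1, |fundSolDeriv p lam x - fundSolDeriv q ν x| ≤ L * d :=
    fun x hx => (abs_fundSol_sub_le hpR hqR hx).2.trans hη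
  have iN : ∀ (r : UnitL2) (ξ : ℝ), IntervalIntegrable (fun x => fundSol r ξ x ^ 2) volume 0 1 :=
    fun r ξ => intervalIntegrable_of_mem_Icc
      ((fundSol_spec r ξ).continuousOn.pow 2).integrableOn_Icc h01
  have hN : |(∫ x in (0 : ℝ)..1, fundSol p lam x ^ 2) - ∫ x in (0 : ℝ)..1, fundSol q ν x ^ 2| ≤
      2 * G * (L * d) := by
    rw [← intervalIntegral.integral_sub (iN p lam) (iN q ν)]
    have := intervalIntegral.norm_integral_le_of_norm_le_const (a := (0 : ℝ)) (b := 1)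
      (f := fun x => fundSol p lam x ^ 2 - fundSol q ν x ^ 2) (C := 2 * G * (L * d)) ?_
    · simpa using this
    · intro x hx
      rw [uIoc_of_le zero_le_one] at hx
      have hx' : x ∈ Icc (0 : ℝ) 1 := ⟨hx.1.le, hx.2⟩
      rw [sq, sq]
      exact abs_mul_sub_mul_le (abs_fundSol_le hpR hx').1 (abs_fundSol_le hqR hx').1
        (hy x hx') (hy x hx')
  simp only [← sq] at hop hoq
  refine norm_le_of_ae_abs_le (by positivity) ?_
  have hae : ∀ᵐ x ∂unitMeasure, x ∈ Icc (0 : ℝ) 1 := ae_restrict_mem measurableSet_Icc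
  filter_upwards [Lp.coeFn_sub (vectorField n p) (vectorField n q), fp, fq, hae]
    with x h1 h2 h3 hx
  rw [h1, Pi.sub_apply, h2, h3, mul_div_assoc 4, mul_div_assoc 4, ← mul_sub, abs_mul,
    abs_of_pos (by norm_num : (0 : ℝ) < 4)]
  have hb : |fundSol q ν x * fundSolDeriv q ν x| ≤ G * G := by
    rw [abs_mul]
    exact mul_le_mul (abs_fundSol_le hqR hx).1 (abs_fundSol_le hqR hx).2 (abs_nonneg _) hG.le
  have hm := abs_div_sub_div_le hc hop hoq hb
    (abs_mul_sub_mul_le (abs_fundSol_le hpR hx).1 (abs_fundSol_le hqR hx).2 (hy x hx)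
      (hy₁ x hx)) hN
  calc _ ≤ 4 * ((1 / c + G * G / c ^ 2) * (2 * G * (L * d))) :=
        mul_le_mul_of_nonneg_left hm (by norm_num)
    _ = C * d := by rw [hC]; ring

/-- Two flow lines agree near time `0`. -/
theorem IsFlowLine.eventuallyEq {n : ℕ} (hn : 1 ≤ n) {γ γ' : ℝ → UnitL2} (h : IsFlowLine n γ)
    (h' : IsFlowLine n γ') : γ =ᶠ[𝓝 0] γ' := by
  obtain ⟨s, hs, K, hK⟩ := exists_lipschitzOnWith_vectorField hn
  have hmem : ∀ {γ : ℝ → UnitL2}, IsFlowLine n γ →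
      ∀ᶠ t in 𝓝 (0 : ℝ), HasDerivAt γ (vectorField n (γ t)) t ∧ γ t ∈ s := by
    intro γ h
    have : γ ⁻¹' s ∈ 𝓝 (0 : ℝ) := (h.2 0).continuousAt.preimage_mem_nhds (by rwa [h.1])
    filter_upwards [this] with t ht using ⟨h.2 t, ht⟩
  exact ODE_solution_unique_of_eventually (v := fun _ => vectorField n) (s := fun _ => s)
    (Eventually.of_forall fun _ => hK) (hmem h) (hmem h') (by rw [h.1, h'.1])

/-! ### The explicit isospectral flow through the zero potential -/

/-- The normalized Dirichlet eigenfunction `√2 sin (jπx)` of `-d²/dx²`. -/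
def sineMode (j : ℕ) (x : ℝ) : ℝ := Real.sqrt 2 * Real.sin (j * Real.pi * x)

/-- The derivative of `sineMode j`. -/
def sineModeDeriv (j : ℕ) (x : ℝ) : ℝ := Real.sqrt 2 * (j * Real.pi) * Real.cos (j * Real.pi * x)

theorem hasDerivAt_sineMode (j : ℕ) (x : ℝ) :
    HasDerivAt (sineMode j) (sineModeDeriv j x) x := by
  have hl : HasDerivAt (fun x => j * Real.pi * x) (j * Real.pi) x := by
    simpa using (hasDerivAt_id x).const_mul (j * Real.pi)
  refine (hl.sin.const_mul (Real.sqrt 2)).congr_deriv ?_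
  rw [sineModeDeriv]
  ring

theorem hasDerivAt_sineModeDeriv (j : ℕ) (x : ℝ) :
    HasDerivAt (sineModeDeriv j) (-(j * Real.pi) ^ 2 * sineMode j x) x := by
  have hl : HasDerivAt (fun x => j * Real.pi * x) (j * Real.pi) x := by
    simpa using (hasDerivAt_id x).const_mul (j * Real.pi)
  refine (hl.cos.const_mul (Real.sqrt 2 * (j * Real.pi))).congr_deriv ?_
  rw [sineMode]
  ring

@[fun_prop]
theorem continuous_sineMode (j : ℕ) : Continuous (sineMode j) := by
  unfold sineMode; fun_prop

@[fun_prop]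
theorem continuous_sineModeDeriv (j : ℕ) : Continuous (sineModeDeriv j) := by
  unfold sineModeDeriv; fun_prop

theorem sineMode_zero (j : ℕ) : sineMode j 0 = 0 := by simp [sineMode]

theorem sineMode_one (j : ℕ) : sineMode j 1 = 0 := by simp [sineMode]

theorem sineModeDeriv_zero (j : ℕ) : sineModeDeriv j 0 = Real.sqrt 2 * (j * Real.pi) := by
  simp [sineModeDeriv]

/-- The integral of `sineMode n * y` over `[0, x]`. -/
def overlap (n : ℕ) (y : ℝ → ℝ) (x : ℝ) : ℝ := ∫ r in (0 : ℝ)..x, sineMode n r * y r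

theorem overlap_zero (n : ℕ) (y : ℝ → ℝ) : overlap n y 0 = 0 := by simp [overlap]

theorem hasDerivAt_overlap (n : ℕ) {y : ℝ → ℝ} (hy : Continuous y) (x : ℝ) :
    HasDerivAt (overlap n y) (sineMode n x * y x) x :=
  (((continuous_sineMode n).mul hy).integral_hasStrictDerivAt 0 x).hasDerivAt

theorem continuous_overlap (n : ℕ) {y : ℝ → ℝ} (hy : Continuous y) : Continuous (overlap n y) :=
  continuous_iff_continuousAt.2 fun x => (hasDerivAt_overlap n hy x).continuousAt

/-- The integral of the squared `n`-th mode over `[0, x]`. -/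
def modeMass (n : ℕ) (x : ℝ) : ℝ := overlap n (sineMode n) x

theorem hasDerivAt_modeMass (n : ℕ) (x : ℝ) : HasDerivAt (modeMass n) (sineMode n x ^ 2) x := by
  rw [sq]; exact hasDerivAt_overlap n (continuous_sineMode n) x

@[fun_prop]
theorem continuous_modeMass (n : ℕ) : Continuous (modeMass n) :=
  continuous_overlap n (continuous_sineMode n)

theorem modeMass_zero (n : ℕ) : modeMass n 0 = 0 := overlap_zero _ _

theorem modeMass_one {n : ℕ} (hn : 1 ≤ n) : modeMass n 1 = 1 := by
  have hp : (n : ℝ) * Real.pi ≠ 0 :=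
    mul_ne_zero (Nat.cast_ne_zero.2 (by omega)) Real.pi_ne_zero
  have hd : ∀ x ∈ uIcc (0 : ℝ) 1, HasDerivAt
      (fun x => x - Real.sin (2 * (n * Real.pi) * x) / (2 * (n * Real.pi)))
      (sineMode n x * sineMode n x) x := by
    intro x _
    refine ((hasDerivAt_id x).sub
      (hasDerivAt_sin_mul_div (mul_ne_zero two_ne_zero hp) x)).congr_deriv ?_
    rw [sineMode, mul_assoc 2 (n * Real.pi) x, Real.cos_two_mul, Real.cos_sq']
    nlinarith [Real.mul_self_sqrt (zero_le_two (α := ℝ))]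
  rw [modeMass, overlap, intervalIntegral.integral_eq_sub_of_hasDerivAt hd
    (((continuous_sineMode n).mul (continuous_sineMode n)).intervalIntegrable _ _)]
  have : Real.sin (2 * (n * Real.pi) * 1) = 0 := by
    rw [mul_one, ← mul_assoc, ← Nat.cast_two, ← Nat.cast_mul, Real.sin_nat_mul_pi]
  rw [this]
  simp

theorem monotone_modeMass (n : ℕ) : Monotone (modeMass n) :=
  monotone_of_deriv_nonneg (fun x => (hasDerivAt_modeMass n x).differentiableAt) fun x => by
    rw [(hasDerivAt_modeMass n x).deriv]; positivity

theorem modeMass_mem {n : ℕ} (hn : 1 ≤ n) {x : ℝ} (hx : x ∈ Icc (0 : ℝ) 1) :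
    modeMass n x ∈ Icc (0 : ℝ) 1 :=
  ⟨(modeMass_zero n).symm.trans_le (monotone_modeMass n hx.1),
    (monotone_modeMass n hx.2).trans_eq (modeMass_one hn)⟩

/-- The function `1 + κ ∫₀ˣ g²` whose logarithm generates the flow, `g` the `n`-th mode. -/
def tauFun (n : ℕ) (κ x : ℝ) : ℝ := 1 + κ * modeMass n x

/-- The value is a convex combination of 1 and 1 + κ. -/
theorem tauFun_pos {n : ℕ} (hn : 1 ≤ n) {κ x : ℝ} (hκ : -1 < κ) (hx : x ∈ Icc (0 : ℝ) 1) :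
    0 < tauFun n κ x := by
  obtain ⟨h0, h1⟩ := modeMass_mem hn hx
  rw [tauFun]
  rcases h0.eq_or_lt with h | h
  · rw [← h]; norm_num
  · nlinarith

theorem hasDerivAt_tauFun (n : ℕ) (κ x : ℝ) :
    HasDerivAt (tauFun n κ) (κ * sineMode n x ^ 2) x :=
  ((hasDerivAt_modeMass n x).const_mul κ).const_add 1

theorem tauFun_one {n : ℕ} (hn : 1 ≤ n) (κ : ℝ) : tauFun n κ 1 = 1 + κ := by
  rw [tauFun, modeMass_one hn, mul_one]

@[fun_prop]
theorem continuous_tauFun (n : ℕ) (κ : ℝ) : Continuous (tauFun n κ) := by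
  unfold tauFun; fun_prop

/-- The potential `-2 (log τ)''`. -/
def darbouxFun (n : ℕ) (κ x : ℝ) : ℝ :=
  -4 * κ * (sineMode n x * sineModeDeriv n x) / tauFun n κ x +
    2 * κ ^ 2 * sineMode n x ^ 4 / tauFun n κ x ^ 2

theorem continuousOn_darbouxFun {n : ℕ} (hn : 1 ≤ n) {κ : ℝ} (hκ : -1 < κ) :
    ContinuousOn (darbouxFun n κ) (Icc (0 : ℝ) 1) := by
  unfold darbouxFun
  refine ContinuousOn.add (ContinuousOn.div (by fun_prop) (by fun_prop) fun x hx => ?_)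
    (ContinuousOn.div (by fun_prop) (by fun_prop) fun x hx => ?_)
  · exact (tauFun_pos hn hκ hx).ne'
  · exact pow_ne_zero 2 (tauFun_pos hn hκ hx).ne'

/-- The double commutation transform of `y`. -/
def darbouxSol (n : ℕ) (κ : ℝ) (y : ℝ → ℝ) (x : ℝ) : ℝ :=
  y x - κ * (sineMode n x / tauFun n κ x * overlap n y x)

/-- The derivative of `darbouxSol n κ y`. -/
def darbouxSolDeriv (n : ℕ) (κ : ℝ) (y y₁ : ℝ → ℝ) (x : ℝ) : ℝ :=
  y₁ x - κ * ((sineModeDeriv n x / tauFun n κ x - κ * sineMode n x ^ 3 / tauFun n κ x ^ 2) *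
    overlap n y x + sineMode n x / tauFun n κ x * (sineMode n x * y x))

theorem hasDerivAt_sineMode_div_tauFun {n : ℕ} {κ x : ℝ} (hτ : tauFun n κ x ≠ 0) :
    HasDerivAt (fun x => sineMode n x / tauFun n κ x)
      (sineModeDeriv n x / tauFun n κ x - κ * sineMode n x ^ 3 / tauFun n κ x ^ 2) x := by
  refine ((hasDerivAt_sineMode n x).div (hasDerivAt_tauFun n κ x) hτ).congr_deriv ?_
  field_simp

theorem hasDerivAt_darbouxSol {n : ℕ} {κ x : ℝ} {y y₁ : ℝ → ℝ} (hτ : tauFun n κ x ≠ 0)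
    (hy : ∀ x, HasDerivAt y (y₁ x) x) :
    HasDerivAt (darbouxSol n κ y) (darbouxSolDeriv n κ y y₁ x) x := by
  have hyc : Continuous y := continuous_iff_continuousAt.2 fun x => (hy x).continuousAt
  exact (hy x).sub (((hasDerivAt_sineMode_div_tauFun hτ).mul
    (hasDerivAt_overlap n hyc x)).const_mul κ)

/-- The Wronskian g'y - gy' has derivative (lam - (nπ)²)gy and vanishes at 0. It expresses the
nonlocal term of the transform through local ones, and at x = 1 gives orthogonality of the modes. -/
theorem sub_mul_overlap {n : ℕ} {lam : ℝ} {y y₁ : ℝ → ℝ} (hy : ∀ x, HasDerivAt y (y₁ x) x)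
    (hy₁ : ∀ x, HasDerivAt y₁ (-lam * y x) x) (h0 : y 0 = 0) (x : ℝ) :
    (lam - (n * Real.pi) ^ 2) * overlap n y x =
      sineModeDeriv n x * y x - sineMode n x * y₁ x := by
  have hyc : Continuous y := continuous_iff_continuousAt.2 fun x => (hy x).continuousAt
  have hd : ∀ x, HasDerivAt (fun x => sineModeDeriv n x * y x - sineMode n x * y₁ x)
      ((lam - (n * Real.pi) ^ 2) * (sineMode n x * y x)) x := by
    intro x
    refine (((hasDerivAt_sineModeDeriv n x).mul (hy x)).sub
      ((hasDerivAt_sineMode n x).mul (hy₁ x))).congr_deriv ?_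
    ring
  have := intervalIntegral.integral_eq_sub_of_hasDerivAt (a := 0) (b := x) (fun x _ => hd x)
    ((continuous_const.mul ((continuous_sineMode n).mul hyc)).intervalIntegrable _ _)
  rw [intervalIntegral.integral_const_mul, h0, sineMode_zero] at this
  simpa [overlap] using this

theorem hasDerivAt_darbouxSolDeriv {n : ℕ} {κ lam x : ℝ} {y y₁ : ℝ → ℝ}
    (hτ : tauFun n κ x ≠ 0) (hy : ∀ x, HasDerivAt y (y₁ x) x)
    (hy₁ : ∀ x, HasDerivAt y₁ (-lam * y x) x) (h0 : y 0 = 0) :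
    HasDerivAt (darbouxSolDeriv n κ y y₁) ((darbouxFun n κ x - lam) * darbouxSol n κ y x) x := by
  have hyc : Continuous y := continuous_iff_continuousAt.2 fun x => (hy x).continuousAt
  have hg := hasDerivAt_sineMode n x
  have hg₁ := hasDerivAt_sineModeDeriv n x
  have hτd := hasDerivAt_tauFun n κ x
  have hW := sub_mul_overlap (n := n) hy hy₁ h0 x
  have hr₁ := (hg₁.div hτd hτ).sub (((hg.pow 3).const_mul κ).div (hτd.pow 2) (pow_ne_zero 2 hτ))
  refine ((hy₁ x).sub (((hr₁.mul (hasDerivAt_overlap n hyc x)).add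
    ((hasDerivAt_sineMode_div_tauFun hτ).mul (hg.mul (hy x)))).const_mul κ)).congr_deriv ?_
  simp only [darbouxSol, darbouxFun, Pi.div_apply, Pi.sub_apply, Pi.pow_apply, Pi.mul_apply]
  generalize tauFun n κ x = τ at hτ ⊢
  generalize sineMode n x = g at hW ⊢
  generalize sineModeDeriv n x = g₁ at hW ⊢
  generalize overlap n y x = w at hW ⊢
  norm_num
  rw [← sub_eq_zero]
  rw [← sub_eq_zero] at hW
  -- Up to field algebra, the two sides differ exactly by -κg/τ times the Wronskian identity.
  refine Eq.trans ?_ (mul_eq_zero_of_right (-κ * g / τ) hW)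
  field_simp
  ring

theorem memLp_of_continuousOn {f : ℝ → ℝ} (hf : ContinuousOn f (Icc (0 : ℝ) 1)) :
    MemLp f 2 unitMeasure := by
  obtain ⟨C, hC⟩ := isCompact_Icc.exists_bound_of_continuousOn hf
  exact MemLp.of_bound (hf.aestronglyMeasurable measurableSet_Icc) C
    ((ae_restrict_iff' measurableSet_Icc).2 (Eventually.of_forall hC))

/-- The potential `-2 (log τ)''` as an element of `L²`. -/
def darbouxPotential {n : ℕ} (hn : 1 ≤ n) {κ : ℝ} (hκ : -1 < κ) : UnitL2 :=
  (memLp_of_continuousOn (continuousOn_darbouxFun hn hκ)).toLp (darbouxFun n κ)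

theorem isIVPSolution_darbouxSol {n : ℕ} (hn : 1 ≤ n) {κ : ℝ} (hκ : -1 < κ) {lam : ℝ}
    {y y₁ : ℝ → ℝ} (hy : ∀ x, HasDerivAt y (y₁ x) x) (hy₁ : ∀ x, HasDerivAt y₁ (-lam * y x) x)
    (h0 : y 0 = 0) :
    IsIVPSolution (fun x => darbouxPotential hn hκ x - lam) (y₁ 0) (darbouxSol n κ y)
      (darbouxSolDeriv n κ y y₁) := by
  have hτ : ∀ x ∈ Icc (0 : ℝ) 1, tauFun n κ x ≠ 0 := fun x hx => (tauFun_pos hn hκ hx).ne'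
  refine (IsIVPSolution.of_hasDerivAt (V := fun x => darbouxFun n κ x - lam)
    ((continuousOn_darbouxFun hn hκ).sub continuousOn_const)
    (fun x hx => hasDerivAt_darbouxSol (hτ x hx) hy)
    (fun x hx => hasDerivAt_darbouxSolDeriv (hτ x hx) hy hy₁ h0) ?_ ?_).congr ?_
  · simp [darbouxSol, h0, overlap_zero]
  · simp [darbouxSolDeriv, overlap_zero, sineMode_zero]
  · filter_upwards [MemLp.coeFn_toLp (memLp_of_continuousOn (continuousOn_darbouxFun hn hκ))]
      with x hx
    rw [darbouxPotential, hx]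

/-- The correction carries the factor g, which vanishes at 1. The shooting function is thus
unchanged for every λ, which is the source of isospectrality. -/
theorem darbouxSol_one (n : ℕ) (κ : ℝ) (y : ℝ → ℝ) : darbouxSol n κ y 1 = y 1 := by
  simp [darbouxSol, sineMode_one]

/-- The potentials `-2 (log τ)''` are isospectral with the zero potential. -/
theorem isDirichletEigenvalue_darbouxPotential {n : ℕ} (hn : 1 ≤ n) {κ : ℝ} (hκ : -1 < κ)
    (lam : ℝ) : IsDirichletEigenvalue (darbouxPotential hn hκ) lam ↔
      ∃ j : ℕ, 1 ≤ j ∧ lam = (j * Real.pi) ^ 2 := by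
  obtain ⟨y, y₁, hy, hy₁, h0, h1, hiff⟩ := exists_free_solution lam
  have h := isIVPSolution_darbouxSol hn hκ hy hy₁ h0
  rw [h1] at h
  rw [isDirichletEigenvalue_iff h, darbouxSol_one, hiff]

theorem dirichletEigenvalue_darbouxPotential {n : ℕ} (hn : 1 ≤ n) {κ : ℝ} (hκ : -1 < κ)
    {j : ℕ} (hj : 1 ≤ j) :
    dirichletEigenvalue (darbouxPotential hn hκ) j = (j * Real.pi) ^ 2 :=
  dirichletEigenvalue_eq_of_spectrum (isDirichletEigenvalue_darbouxPotential hn hκ) hj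

theorem isIVPSolution_darbouxSol_sineMode {n : ℕ} (hn : 1 ≤ n) {κ : ℝ} (hκ : -1 < κ) {j : ℕ}
    (hj : 1 ≤ j) :
    IsIVPSolution
      (fun x => darbouxPotential hn hκ x - dirichletEigenvalue (darbouxPotential hn hκ) j)
      (Real.sqrt 2 * (j * Real.pi)) (darbouxSol n κ (sineMode j))
      (darbouxSolDeriv n κ (sineMode j) (sineModeDeriv j)) := by
  rw [dirichletEigenvalue_darbouxPotential hn hκ hj, ← sineModeDeriv_zero]
  exact isIVPSolution_darbouxSol hn hκ (hasDerivAt_sineMode j) (hasDerivAt_sineModeDeriv j)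
    (sineMode_zero j)

/-- The square is an exact derivative, that of ∫₀ˣ g_j² - κw²/τ with w = ∫₀ˣ g g_j. -/
theorem integral_darbouxSol_sq {n : ℕ} (hn : 1 ≤ n) {κ : ℝ} (hκ : -1 < κ) {j : ℕ}
    (hj : 1 ≤ j) :
    ∫ x in (0 : ℝ)..1, darbouxSol n κ (sineMode j) x ^ 2 =
      1 - κ * overlap n (sineMode j) 1 ^ 2 / (1 + κ) := by
  have hτ : ∀ x ∈ uIcc (0 : ℝ) 1, tauFun n κ x ≠ 0 := fun x hx => by
    rw [uIcc_of_le zero_le_one] at hx; exact (tauFun_pos hn hκ hx).ne'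
  have hd : ∀ x ∈ uIcc (0 : ℝ) 1, HasDerivAt
      (fun x => modeMass j x - κ * overlap n (sineMode j) x ^ 2 / tauFun n κ x)
      (darbouxSol n κ (sineMode j) x ^ 2) x := by
    intro x hx
    refine ((hasDerivAt_modeMass j x).sub
      ((((hasDerivAt_overlap n (continuous_sineMode j) x).pow 2).const_mul κ).div
        (hasDerivAt_tauFun n κ x) (hτ x hx))).congr_deriv ?_
    have := hτ x hx
    simp only [darbouxSol, Pi.pow_apply]
    field_simp
    norm_num
    ring
  rw [intervalIntegral.integral_eq_sub_of_hasDerivAt hd, modeMass_one hj, tauFun_one hn,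
    modeMass_zero, overlap_zero]
  · simp
  · exact intervalIntegrable_of_mem_Icc
      ((isIVPSolution_darbouxSol_sineMode hn hκ hj).continuousOn.pow 2).integrableOn_Icc
      (right_mem_Icc.2 zero_le_one)

/-- For j = n the overlap is the mass function, and κ times it is τ - 1, so the transform collapses.
-/
theorem darbouxSol_sineMode_self {n : ℕ} {κ x : ℝ} (hτ : tauFun n κ x ≠ 0) :
    darbouxSol n κ (sineMode n) x = sineMode n x / tauFun n κ x := by
  rw [darbouxSol]
  change _ - κ * (_ * modeMass n x) = _
  field_simp
  rw [tauFun]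
  ring

theorem darbouxSolDeriv_sineMode_self {n : ℕ} {κ x : ℝ} (hτ : tauFun n κ x ≠ 0) :
    darbouxSolDeriv n κ (sineMode n) (sineModeDeriv n) x =
      sineModeDeriv n x / tauFun n κ x - κ * sineMode n x ^ 3 / tauFun n κ x ^ 2 := by
  rw [darbouxSolDeriv]
  change _ - κ * (_ * modeMass n x + _) = _
  have : κ * modeMass n x = tauFun n κ x - 1 := by rw [tauFun]; ring
  rw [← sub_eq_zero]
  rw [← sub_eq_zero] at this
  refine Eq.trans ?_ (mul_eq_zero_of_right
    (-(sineModeDeriv n x / tauFun n κ x - κ * sineMode n x ^ 3 / tauFun n κ x ^ 2)) this)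
  field_simp
  ring

/-- The vector field along the explicit isospectral family. -/
theorem vectorField_darbouxPotential {n : ℕ} (hn : 1 ≤ n) {κ : ℝ} (hκ : -1 < κ) :
    vectorField n (darbouxPotential hn hκ) =ᵐ[unitMeasure] fun x =>
      4 * (1 + κ) * (sineMode n x / tauFun n κ x *
        (sineModeDeriv n x / tauFun n κ x - κ * sineMode n x ^ 3 / tauFun n κ x ^ 2)) := by
  have h := isIVPSolution_darbouxSol_sineMode hn hκ hn
  have hc : Real.sqrt 2 * (n * Real.pi) ≠ 0 :=
    mul_ne_zero (by positivity) (mul_ne_zero (Nat.cast_ne_zero.2 (by omega)) Real.pi_ne_zero)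
  have h' := h.const_mul (Real.sqrt 2 * (n * Real.pi))⁻¹
  rw [inv_mul_cancel₀ hc] at h'
  have hκ' : 1 + κ ≠ 0 := by linarith
  filter_upwards [vectorField_ae_eq h' (by rw [darbouxSol_one, sineMode_one, mul_zero]),
    ae_restrict_mem measurableSet_Icc] with x hx hmem
  have hτ := (tauFun_pos hn hκ hmem).ne'
  rw [hx]
  simp only [mul_pow, intervalIntegral.integral_const_mul]
  have hone : overlap n (sineMode n) 1 = 1 := modeMass_one hn
  rw [integral_darbouxSol_sq hn hκ hn, hone, darbouxSol_sineMode_self hτ,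
    darbouxSolDeriv_sineMode_self hτ]
  have e : 1 - κ * 1 ^ 2 / (1 + κ) = (1 + κ)⁻¹ := by field_simp; ring
  rw [e]
  generalize sineMode n x / tauFun n κ x = a
  generalize sineModeDeriv n x / tauFun n κ x - κ * sineMode n x ^ 3 / tauFun n κ x ^ 2 = b
  field_simp

/-- Differentiation of curves in `L²` given by continuous integrands. -/
theorem hasDerivAt_toLp {F F' : ℝ → ℝ → ℝ} (hF : ∀ s, MemLp (F s) 2 unitMeasure) {s₀ : ℝ}
    (hF' : MemLp (F' s₀) 2 unitMeasure)
    (hd : ∀ s, ∀ x ∈ Icc (0 : ℝ) 1, HasDerivAt (fun s => F s x) (F' s x) s)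
    (hc : ContinuousOn (Function.uncurry F') (univ ×ˢ Icc (0 : ℝ) 1)) :
    HasDerivAt (fun s => (hF s).toLp (F s)) (hF'.toLp (F' s₀)) s₀ := by
  rw [hasDerivAt_iff_isLittleO, Asymptotics.isLittleO_iff]
  intro ε hε
  -- Joint continuity and compactness make F' s close to F' s₀ uniformly in x. The mean value
  -- inequality for s ↦ F s x - s F' s₀ x then gives a uniform error bound, which suffices for the
  -- L² norm.
  obtain ⟨v, hv, hvε⟩ := isCompact_Icc.mem_uniformity_of_prod hc (mem_univ s₀)
    (Metric.dist_mem_uniformity hε)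
  rw [nhdsWithin_univ] at hv
  obtain ⟨δ, hδ, hball⟩ := Metric.mem_nhds_iff.1 hv
  filter_upwards [Metric.ball_mem_nhds s₀ hδ] with s hs
  refine norm_le_of_ae_abs_le (by positivity) ?_
  have hmem : ∀ᵐ x ∂unitMeasure, x ∈ Icc (0 : ℝ) 1 := ae_restrict_mem measurableSet_Icc
  filter_upwards [Lp.coeFn_sub ((hF s).toLp (F s) - (hF s₀).toLp (F s₀))
    ((s - s₀) • hF'.toLp (F' s₀)), Lp.coeFn_sub ((hF s).toLp (F s)) ((hF s₀).toLp (F s₀)),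
    Lp.coeFn_smul (s - s₀) (hF'.toLp (F' s₀)), (hF s).coeFn_toLp, (hF s₀).coeFn_toLp,
    hF'.coeFn_toLp, hmem] with x h1 h2 h3 h4 h5 h6 hx
  rw [h1, Pi.sub_apply, h2, Pi.sub_apply, h3, Pi.smul_apply, h4, h5, h6]
  have := (convex_ball s₀ δ).norm_image_sub_le_of_norm_hasDerivWithin_le (C := ε)
    (f := fun s => F s x - s * F' s₀ x) (f' := fun s => F' s x - F' s₀ x)
    (fun r _ => ((hd r x hx).sub
      ((hasDerivAt_id r).mul_const (F' s₀ x) |>.congr_deriv (one_mul _))).hasDerivWithinAt)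
    (fun r hr => (hvε r (hball hr) x hx).le) (Metric.mem_ball_self hδ) hs
  refine le_trans (le_of_eq ?_) this
  rw [Real.norm_eq_abs]
  congr 1
  simp only [smul_eq_mul]
  ring

/-- κ = e^{-s} - 1 solves κ' = -(1 + κ), κ(0) = 0, as the flow demands; it never reaches -1, so the
flow exists for all times. -/
theorem neg_one_lt_exp_neg_sub_one (s : ℝ) : -1 < Real.exp (-s) - 1 := by
  linarith [Real.exp_pos (-s)]

/-- The explicit solution of the flow through `0`. -/
def explicitFlow {n : ℕ} (hn : 1 ≤ n) (s : ℝ) : UnitL2 :=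
  darbouxPotential hn (neg_one_lt_exp_neg_sub_one s)

/-- Let m = ∫₀ˣ g². Since τ - κm = 1, ∂_κ log τ = m/τ has x-derivative g²/τ², so ∂_κ(-2(log τ)'') =
-4(g/τ)(g/τ)'. Multiplying by κ' = -(1 + κ) gives the field computed in
`vectorField_darbouxPotential`. -/
theorem isFlowLine_explicitFlow {n : ℕ} (hn : 1 ≤ n) : IsFlowLine n (explicitFlow hn) := by
  constructor
  · rw [explicitFlow, darbouxPotential]
    have : darbouxFun n (Real.exp (-0) - 1) = 0 := by
      ext x; simp [darbouxFun]
    simp only [this]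
    rfl
  · intro s
    have hτ : ∀ s, ∀ x ∈ Icc (0 : ℝ) 1, tauFun n (Real.exp (-s) - 1) x ≠ 0 := fun s x hx =>
      (tauFun_pos hn (neg_one_lt_exp_neg_sub_one s) hx).ne'
    set F' : ℝ → ℝ → ℝ := fun s x => 4 * (1 + (Real.exp (-s) - 1)) *
      (sineMode n x / tauFun n (Real.exp (-s) - 1) x *
        (sineModeDeriv n x / tauFun n (Real.exp (-s) - 1) x -
          (Real.exp (-s) - 1) * sineMode n x ^ 3 / tauFun n (Real.exp (-s) - 1) x ^ 2)) with hF'def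
    have hcτ : Continuous fun p : ℝ × ℝ => tauFun n (Real.exp (-p.1) - 1) p.2 := by
      unfold tauFun; fun_prop
    have hc : ContinuousOn (Function.uncurry F') (univ ×ˢ Icc (0 : ℝ) 1) := by
      have hne : ∀ p ∈ univ ×ˢ Icc (0 : ℝ) 1, tauFun n (Real.exp (-p.1) - 1) p.2 ≠ 0 :=
        fun p hp => hτ p.1 p.2 hp.2
      simp only [hF'def, Function.uncurry_def]
      refine ContinuousOn.mul (by fun_prop) (ContinuousOn.mul (ContinuousOn.div (by fun_prop)
        hcτ.continuousOn hne) (ContinuousOn.sub (ContinuousOn.div (by fun_prop)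
        hcτ.continuousOn hne) (ContinuousOn.div (by fun_prop)
        (hcτ.continuousOn.pow 2) fun p hp => pow_ne_zero 2 (hne p hp))))
    have hcs : ContinuousOn (F' s) (Icc (0 : ℝ) 1) :=
      hc.comp (f := fun x => (s, x)) (by fun_prop) fun x hx => ⟨mem_univ _, hx⟩
    have hmem := memLp_of_continuousOn hcs
    have hd : ∀ s, ∀ x ∈ Icc (0 : ℝ) 1,
        HasDerivAt (fun s => darbouxFun n (Real.exp (-s) - 1) x) (F' s x) s := by
      intro s x hx
      have hκ : HasDerivAt (fun s => Real.exp (-s) - 1) (-Real.exp (-s)) s := by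
        simpa using ((hasDerivAt_neg s).exp).sub_const 1
      have hτd : HasDerivAt (fun s => tauFun n (Real.exp (-s) - 1) x)
          (-Real.exp (-s) * modeMass n x) s := (hκ.mul_const (modeMass n x)).const_add 1
      have hne := hτ s x hx
      refine ((((hκ.const_mul (-4)).mul_const (sineMode n x * sineModeDeriv n x)).div hτd hne).add
        ((((hκ.pow 2).const_mul 2).mul_const (sineMode n x ^ 4)).div (hτd.pow 2)
          (pow_ne_zero 2 hne))).congr_deriv ?_
      have hm : (Real.exp (-s) - 1) * modeMass n x = tauFun n (Real.exp (-s) - 1) x - 1 := by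
        rw [tauFun]; ring
      simp only [hF'def, Pi.pow_apply]
      generalize tauFun n (Real.exp (-s) - 1) x = τ at hm hne ⊢
      generalize sineMode n x = g
      generalize sineModeDeriv n x = g₁
      generalize modeMass n x = m at hm ⊢
      generalize Real.exp (-s) = E at hm ⊢
      norm_num
      rw [← sub_eq_zero] at hm
      rw [← sub_eq_zero]
      -- The mass enters only through κm = τ - 1; the displayed factor is the cofactor of that
      -- relation in the identity to be checked.
      refine Eq.trans ?_ (mul_eq_zero_of_right
        (-4 * E * g * g₁ / τ ^ 2 + 4 * (E - 1) * E * g ^ 4 / τ ^ 3) hm)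
      field_simp
      ring
    have key := hasDerivAt_toLp (F := fun s => darbouxFun n (Real.exp (-s) - 1)) (F' := F')
      (fun s => memLp_of_continuousOn (continuousOn_darbouxFun hn (neg_one_lt_exp_neg_sub_one s)))
      (s₀ := s) hmem hd hc
    have hv : vectorField n (explicitFlow hn s) = hmem.toLp (F' s) :=
      Lp.ext ((vectorField_darbouxPotential hn (neg_one_lt_exp_neg_sub_one s)).trans
        hmem.coeFn_toLp.symm)
    rw [hv]
    exact key

theorem vectorField_zero_ne_zero {n : ℕ} (hn : 1 ≤ n) : vectorField n 0 ≠ 0 := by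
  intro h
  have h0 := (isFlowLine_explicitFlow hn).1
  have hae := vectorField_darbouxPotential hn (neg_one_lt_exp_neg_sub_one 0)
  change vectorField n (explicitFlow hn 0) =ᵐ[unitMeasure] _ at hae
  rw [h0, h] at hae
  have hae' : (fun x => 4 * (sineMode n x * sineModeDeriv n x)) =ᵐ[volume.restrict (Ioo (0 : ℝ) 1)]
      fun _ => (0 : ℝ) := by
    rw [restrict_Ioo_eq_restrict_Icc]
    filter_upwards [hae, Lp.coeFn_zero ℝ 2 unitMeasure] with x hx hx0
    rw [hx0] at hx
    simpa [tauFun] using hx.symm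
  have heq := Measure.eqOn_open_of_ae_eq hae' isOpen_Ioo (by fun_prop) (by fun_prop)
  have hn0 : (1 : ℝ) ≤ n := by exact_mod_cast hn
  -- At this point nπx = π/4, where sine and cosine are both positive, so the continuous function
  -- 4gg' is not zero.
  have hx : 1 / (4 * (n : ℝ)) ∈ Ioo (0 : ℝ) 1 := by
    refine ⟨by positivity, ?_⟩
    rw [div_lt_one (by positivity)]
    linarith
  have := heq hx
  have e : n * Real.pi * (1 / (4 * (n : ℝ))) = Real.pi / 4 := by field_simp
  simp only [sineMode, sineModeDeriv, e, Real.sin_pi_div_four, Real.cos_pi_div_four] at this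
  have hp := Real.pi_pos
  have hs : 0 < Real.sqrt 2 := by positivity
  have hpos : 0 < 4 * (Real.sqrt 2 * (Real.sqrt 2 / 2) *
      (Real.sqrt 2 * (n * Real.pi) * (Real.sqrt 2 / 2))) := by positivity
  exact hpos.ne' this

/-! ### The heat content along the flow -/

theorem sineMode_one_sub (j : ℕ) (x : ℝ) :
    sineMode j (1 - x) = (-1) ^ (j + 1) * sineMode j x := by
  rw [sineMode, sineMode, mul_sub, mul_one, Real.sin_nat_mul_pi_sub]
  ring

theorem abs_sineMode_le (j : ℕ) (x : ℝ) : |sineMode j x| ≤ 3 / 2 := by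
  have h : Real.sqrt 2 ≤ 3 / 2 := by
    rw [Real.sqrt_le_left (by norm_num)]; norm_num
  rw [sineMode, abs_mul, abs_of_nonneg (Real.sqrt_nonneg 2)]
  exact (mul_le_of_le_one_right (Real.sqrt_nonneg 2) (Real.abs_sin_le_one _)).trans h

theorem abs_integral_le_of_abs_le {f : ℝ → ℝ} {C x : ℝ} (hC : 0 ≤ C) (hx : x ∈ Icc (0 : ℝ) 1)
    (hf : ∀ r ∈ Icc (0 : ℝ) 1, |f r| ≤ C) : |∫ r in (0 : ℝ)..x, f r| ≤ C := by
  have := intervalIntegral.norm_integral_le_of_norm_le_const (a := (0 : ℝ)) (b := x) (f := f)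
    (C := C) fun r hr => by
      rw [uIoc_of_le hx.1] at hr
      exact hf r ⟨hr.1.le, hr.2.trans hx.2⟩
  rw [Real.norm_eq_abs, sub_zero, abs_of_nonneg hx.1] at this
  exact this.trans (mul_le_of_le_one_right hC hx.2)

theorem abs_overlap_sineMode_le (n j : ℕ) {x : ℝ} (hx : x ∈ Icc (0 : ℝ) 1) :
    |overlap n (sineMode j) x| ≤ 9 / 4 := by
  refine abs_integral_le_of_abs_le (by norm_num) hx fun r _ => ?_
  rw [abs_mul]
  exact (mul_le_mul (abs_sineMode_le n r) (abs_sineMode_le j r) (abs_nonneg _)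
    (by norm_num)).trans_eq (by norm_num)

theorem overlap_one_of_ne {n j : ℕ} (h : j ≠ n) : overlap n (sineMode j) 1 = 0 := by
  have := sub_mul_overlap (n := n) (hasDerivAt_sineMode j) (hasDerivAt_sineModeDeriv j)
    (sineMode_zero j) 1
  rw [sineMode_one, sineMode_one, mul_zero, zero_mul, sub_zero, mul_eq_zero, sub_eq_zero] at this
  exact this.resolve_left fun he => h (strictMono_sq_mul_pi.injective he)

theorem overlap_one_sub (n j : ℕ) (x : ℝ) : overlap n (sineMode j) (1 - x) =
    (-1) ^ (n + 1) * (-1) ^ (j + 1) *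
      (overlap n (sineMode j) 1 - overlap n (sineMode j) x) := by
  have hi : ∀ a b, IntervalIntegrable (fun r => sineMode n r * sineMode j r) volume a b :=
    fun a b => (by fun_prop : Continuous fun r => sineMode n r * sineMode j r).intervalIntegrable a b
  have h1 := intervalIntegral.integral_comp_sub_left (a := x) (b := 1)
    (fun r => sineMode n r * sineMode j r) 1
  rw [sub_self] at h1
  rw [overlap, overlap, overlap, ← h1,
    intervalIntegral.integral_interval_sub_left (hi _ _) (hi _ _),
    ← intervalIntegral.integral_const_mul]
  congr 1
  ext r
  rw [sineMode_one_sub, sineMode_one_sub]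
  ring

theorem integral_comp_one_sub (f : ℝ → ℝ) :
    ∫ x in (0 : ℝ)..1, f (1 - x) = ∫ x in (0 : ℝ)..1, f x := by
  simp [intervalIntegral.integral_comp_sub_left (fun x => f x) 1]

/-- The first variation of the mean of the `j`-th mode, by reflection about `1/2`. -/
theorem two_mul_integral_mul_integral_overlap (n j : ℕ) :
    2 * (∫ x in (0 : ℝ)..1, sineMode j x) *
        (∫ x in (0 : ℝ)..1, sineMode n x * overlap n (sineMode j) x) =
      overlap n (sineMode j) 1 * (∫ x in (0 : ℝ)..1, sineMode j x) *
        ∫ x in (0 : ℝ)..1, sineMode n x := by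
  set α := ∫ x in (0 : ℝ)..1, sineMode j x with hα
  set β := ∫ x in (0 : ℝ)..1, sineMode n x * overlap n (sineMode j) x with hβ
  set b := overlap n (sineMode j) 1 with hb
  have hsq : ∀ k : ℕ, ((-1 : ℝ) ^ k) * (-1) ^ k = 1 := fun k => by
    rw [← mul_pow]; simp
  have h1 : α = (-1) ^ (j + 1) * α := by
    rw [hα, ← intervalIntegral.integral_const_mul, ← integral_comp_one_sub (sineMode j)]
    simp only [sineMode_one_sub]
  have hoc := continuous_overlap n (continuous_sineMode j)
  have h2 : β = (-1) ^ (j + 1) * (b * (∫ x in (0 : ℝ)..1, sineMode n x) - β) := by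
    have i1 : IntervalIntegrable (fun x => b * sineMode n x) volume 0 1 :=
      (continuous_const.mul (continuous_sineMode n)).intervalIntegrable _ _
    have i2 : IntervalIntegrable (fun x => sineMode n x * overlap n (sineMode j) x) volume 0 1 :=
      ((continuous_sineMode n).mul hoc).intervalIntegrable _ _
    nth_rewrite 1 [hβ]
    rw [← integral_comp_one_sub, ← intervalIntegral.integral_const_mul, hβ,
      ← intervalIntegral.integral_sub i1 i2,
      ← intervalIntegral.integral_const_mul]
    congr 1
    ext x
    rw [sineMode_one_sub, overlap_one_sub, ← hb]
    linear_combination (-1) ^ (j + 1) * sineMode n x * (b - overlap n (sineMode j) x) * hsq (n + 1)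
  -- For even j, `h1` forces α = 0; for odd j, `h2` gives 2β = b∫g. Multiplying the two relations
  -- cancels the signs and covers both parities.
  have h3 : α * β = α * (b * (∫ x in (0 : ℝ)..1, sineMode n x) - β) := by
    calc α * β = ((-1) ^ (j + 1) * α) *
          ((-1) ^ (j + 1) * (b * (∫ x in (0 : ℝ)..1, sineMode n x) - β)) := by rw [← h1, ← h2]
      _ = _ := by
        linear_combination α * (b * (∫ x in (0 : ℝ)..1, sineMode n x) - β) * hsq (j + 1)
  linear_combination h3

/-- The coefficient of κ is bα² - 2αβ, zero by `h`. The rest is κ² times a factor of size at most 20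
+ 303/2, well below 200. -/
theorem abs_expansion_sub_le {α β ρ κ b : ℝ} (hα : |α| ≤ 2) (hβ : |β| ≤ 5) (hρ : |ρ| ≤ 7)
    (hκ : |κ| ≤ 1 / 2) (hb : |b| ≤ 1) (h : 2 * α * β = b * α * α) :
    |(1 + κ * b) * (α - κ * β + κ ^ 2 * ρ) ^ 2 - α ^ 2| ≤ 200 * κ ^ 2 := by
  have e : (1 + κ * b) * (α - κ * β + κ ^ 2 * ρ) ^ 2 - α ^ 2 =
      (-2 * (b * (α * β)) + (1 + κ * b) * ((β - κ * ρ) ^ 2 + 2 * (α * ρ))) * κ ^ 2 := by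
    linear_combination -κ * h
  rw [e, abs_mul, abs_of_nonneg (sq_nonneg κ)]
  refine mul_le_mul_of_nonneg_right ?_ (sq_nonneg κ)
  have b1 : |b * (α * β)| ≤ 1 * (2 * 5) := by
    rw [abs_mul, abs_mul]; gcongr
  have b2 : |κ * b| ≤ 1 / 2 * 1 := by rw [abs_mul]; gcongr
  have b3 : |κ * ρ| ≤ 1 / 2 * 7 := by rw [abs_mul]; gcongr
  have b4 : |α * ρ| ≤ 2 * 7 := by rw [abs_mul]; gcongr
  have b5 : |β - κ * ρ| ≤ 17 / 2 := (abs_sub _ _).trans (by linarith)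
  have b6 : |(β - κ * ρ) ^ 2 + 2 * (α * ρ)| ≤ 101 := by
    have := pow_le_pow_left₀ (abs_nonneg _) b5 2
    rw [sq_abs] at this
    rw [abs_le] at b4 ⊢
    constructor <;> nlinarith [sq_nonneg (β - κ * ρ)]
  have b7 : |1 + κ * b| ≤ 3 / 2 := by
    rw [abs_le] at b2 ⊢
    constructor <;> linarith
  have b8 : |(1 + κ * b) * ((β - κ * ρ) ^ 2 + 2 * (α * ρ))| ≤ 3 / 2 * 101 := by
    rw [abs_mul]; gcongr
  rw [abs_le] at b1 b8 ⊢
  constructor <;> linarith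

/-- This is the exact expansion 1/τ = 1 - κm/τ, with m the mass function, inserted into the
transform. -/
theorem integral_darbouxSol {n : ℕ} (hn : 1 ≤ n) {κ : ℝ} (hκ : -1 < κ) (j : ℕ) :
    ∫ x in (0 : ℝ)..1, darbouxSol n κ (sineMode j) x =
      (∫ x in (0 : ℝ)..1, sineMode j x) -
        κ * (∫ x in (0 : ℝ)..1, sineMode n x * overlap n (sineMode j) x) +
        κ ^ 2 * ∫ x in (0 : ℝ)..1,
          sineMode n x * overlap n (sineMode j) x * modeMass n x / tauFun n κ x := by
  have hoc := continuous_overlap n (continuous_sineMode j)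
  have hτ : ∀ x ∈ Icc (0 : ℝ) 1, tauFun n κ x ≠ 0 := fun x hx => (tauFun_pos hn hκ hx).ne'
  have i1 := (continuous_sineMode j).intervalIntegrable (μ := volume) 0 1
  have i2 : IntervalIntegrable (fun x => sineMode n x * overlap n (sineMode j) x) volume 0 1 :=
    ((continuous_sineMode n).mul hoc).intervalIntegrable _ _
  have i3 : IntervalIntegrable (fun x =>
      sineMode n x * overlap n (sineMode j) x * modeMass n x / tauFun n κ x) volume 0 1 :=
    intervalIntegrable_of_mem_Icc (ContinuousOn.integrableOn_Icc
      (ContinuousOn.div (by fun_prop) (by fun_prop) hτ)) (right_mem_Icc.2 zero_le_one)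
  rw [← intervalIntegral.integral_const_mul, ← intervalIntegral.integral_const_mul,
    ← intervalIntegral.integral_sub i1 (i2.const_mul κ),
    ← intervalIntegral.integral_add (i1.sub (i2.const_mul κ)) (i3.const_mul _)]
  refine intervalIntegral.integral_congr fun x hx => ?_
  rw [uIcc_of_le zero_le_one] at hx
  have h := hτ x hx
  simp only [darbouxSol]
  field_simp
  rw [tauFun]
  ring

theorem abs_integral_sineMode_le (j : ℕ) : |∫ x in (0 : ℝ)..1, sineMode j x| ≤ 2 :=
  abs_integral_le_of_abs_le (by norm_num) (right_mem_Icc.2 zero_le_one)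
    fun r _ => (abs_sineMode_le j r).trans (by norm_num)

theorem half_le_tauFun {n : ℕ} (hn : 1 ≤ n) {κ x : ℝ} (hκ : |κ| ≤ 1 / 2)
    (hx : x ∈ Icc (0 : ℝ) 1) : 1 / 2 ≤ tauFun n κ x := by
  obtain ⟨h0, h1⟩ := modeMass_mem hn hx
  rw [tauFun]
  nlinarith [(abs_le.1 hκ).1]

/-- Each heat content term varies quadratically along the flow, uniformly in the index. -/
theorem abs_heatContentTerm_sub_le {n : ℕ} (hn : 1 ≤ n) {κ : ℝ} (hκ : -1 < κ)
    (hκ' : |κ| ≤ 1 / 2) {j : ℕ} (hj : 1 ≤ j) (t : ℝ) :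
    |heatContentTerm (darbouxPotential hn hκ) t j -
        Real.exp (-t * (j * Real.pi) ^ 2) * (∫ x in (0 : ℝ)..1, sineMode j x) ^ 2| ≤
      200 * κ ^ 2 * Real.exp (-t * (j * Real.pi) ^ 2) := by
  have hc : Real.sqrt 2 * (j * Real.pi) ≠ 0 :=
    mul_ne_zero (by positivity) (mul_ne_zero (Nat.cast_ne_zero.2 (by omega)) Real.pi_ne_zero)
  have h01 : (1 : ℝ) ∈ Icc (0 : ℝ) 1 := right_mem_Icc.2 zero_le_one
  have hκ0 : 1 + κ ≠ 0 := by linarith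
  rw [heatContentTerm_eq t hc (isIVPSolution_darbouxSol_sineMode hn hκ hj)
    (by rw [darbouxSol_one, sineMode_one]), dirichletEigenvalue_darbouxPotential hn hκ hj,
    integral_darbouxSol_sq hn hκ hj, integral_darbouxSol hn hκ j, ← mul_sub, abs_mul,
    abs_of_pos (Real.exp_pos _), mul_comm (Real.exp _)]
  refine mul_le_mul_of_nonneg_right ?_ (Real.exp_pos _).le
  have hpar := two_mul_integral_mul_integral_overlap n j
  have hα := abs_integral_sineMode_le j
  have hprod : ∀ r ∈ Icc (0 : ℝ) 1, |sineMode n r * overlap n (sineMode j) r| ≤ 7 / 2 := by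
    intro r hr
    rw [abs_mul]
    exact (mul_le_mul (abs_sineMode_le n r) (abs_overlap_sineMode_le n j hr) (abs_nonneg _)
      (by norm_num)).trans (by norm_num)
  have hβ : |∫ x in (0 : ℝ)..1, sineMode n x * overlap n (sineMode j) x| ≤ 5 :=
    (abs_integral_le_of_abs_le (by norm_num) h01 hprod).trans (by norm_num)
  have hρ : |∫ x in (0 : ℝ)..1,
      sineMode n x * overlap n (sineMode j) x * modeMass n x / tauFun n κ x| ≤ 7 := by
    refine abs_integral_le_of_abs_le (by norm_num) h01 fun r hr => ?_
    have hτ := half_le_tauFun hn hκ' hr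
    obtain ⟨m0, m1⟩ := modeMass_mem hn hr
    rw [abs_div, abs_mul, abs_of_nonneg m0, abs_of_pos (by linarith : 0 < tauFun n κ r),
      div_le_iff₀ (by linarith)]
    have := mul_le_mul (hprod r hr) m1 m0 (by norm_num)
    linarith
  -- Here b = δ_{jn}: the transform changes the norm of the n-th mode only. For j ≠ n orthogonality
  -- gives αβ = 0, and for j = n the two means in the reflection identity coincide.
  obtain ⟨b, hb, hbN, hpar'⟩ : ∃ b : ℝ, |b| ≤ 1 ∧
      1 - κ * overlap n (sineMode j) 1 ^ 2 / (1 + κ) = (1 + κ * b)⁻¹ ∧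
      2 * (∫ x in (0 : ℝ)..1, sineMode j x) *
        (∫ x in (0 : ℝ)..1, sineMode n x * overlap n (sineMode j) x) =
        b * (∫ x in (0 : ℝ)..1, sineMode j x) * ∫ x in (0 : ℝ)..1, sineMode j x := by
    by_cases hjn : j = n
    · subst hjn
      have hone : overlap j (sineMode j) 1 = 1 := modeMass_one hj
      rw [hone] at hpar ⊢
      refine ⟨1, by norm_num, ?_, hpar⟩
      field_simp
      ring
    · rw [overlap_one_of_ne hjn] at hpar ⊢
      exact ⟨0, by norm_num, by simp, by rw [hpar]; ring⟩
  rw [hbN, div_inv_eq_mul, mul_comm _ (1 + κ * b)]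
  exact abs_expansion_sub_le hα hβ hρ hκ' hb hpar'

/-! ### Summation over the modes -/

theorem summable_exp_neg_mul_sq {t : ℝ} (ht : 0 < t) :
    Summable fun j : ℕ => Real.exp (-t * (((j + 1 : ℕ) : ℝ) * Real.pi) ^ 2) := by
  refine Summable.of_nonneg_of_le (fun _ => (Real.exp_pos _).le) (fun j => ?_)
    (Real.summable_exp_nat_mul_iff.2 (neg_neg_of_pos ht))
  rw [mul_comm (j : ℝ), Real.exp_le_exp, neg_mul, neg_mul, neg_le_neg_iff]
  refine mul_le_mul_of_nonneg_left ?_ ht.le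
  have hp := Real.pi_gt_three
  have hj : (0 : ℝ) ≤ j := Nat.cast_nonneg j
  push_cast
  have h1 : (j : ℝ) + 1 ≤ (j + 1) * Real.pi := by nlinarith
  nlinarith

theorem summable_exp_mul_integral_sq {t : ℝ} (ht : 0 < t) :
    Summable fun j : ℕ => Real.exp (-t * (((j + 1 : ℕ) : ℝ) * Real.pi) ^ 2) *
      (∫ x in (0 : ℝ)..1, sineMode (j + 1) x) ^ 2 := by
  refine Summable.of_nonneg_of_le (fun _ => by positivity) (fun j => ?_)
    ((summable_exp_neg_mul_sq ht).mul_right 4)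
  refine mul_le_mul_of_nonneg_left ?_ (Real.exp_pos _).le
  have := pow_le_pow_left₀ (abs_nonneg _) (abs_integral_sineMode_le (j + 1)) 2
  rw [sq_abs] at this
  linarith

theorem summable_heatContentTerm_sub {n : ℕ} (hn : 1 ≤ n) {κ : ℝ} (hκ : -1 < κ)
    (hκ' : |κ| ≤ 1 / 2) {t : ℝ} (ht : 0 < t) :
    Summable fun j : ℕ => heatContentTerm (darbouxPotential hn hκ) t (j + 1) -
      Real.exp (-t * (((j + 1 : ℕ) : ℝ) * Real.pi) ^ 2) *
        (∫ x in (0 : ℝ)..1, sineMode (j + 1) x) ^ 2 :=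
  Summable.of_norm_bounded ((summable_exp_neg_mul_sq ht).mul_left (200 * κ ^ 2)) fun j =>
    abs_heatContentTerm_sub_le hn hκ hκ' (Nat.le_add_left 1 j) t

theorem summable_heatContentTerm {n : ℕ} (hn : 1 ≤ n) {κ : ℝ} (hκ : -1 < κ)
    (hκ' : |κ| ≤ 1 / 2) {t : ℝ} (ht : 0 < t) :
    Summable fun j : ℕ => heatContentTerm (darbouxPotential hn hκ) t (j + 1) := by
  simpa using (summable_heatContentTerm_sub hn hκ hκ' ht).add (summable_exp_mul_integral_sq ht)

theorem abs_heatContent_sub_le {n : ℕ} (hn : 1 ≤ n) {κ : ℝ} (hκ : -1 < κ)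
    (hκ' : |κ| ≤ 1 / 2) {t : ℝ} (ht : 0 < t) :
    |heatContent (darbouxPotential hn hκ) t -
        ∑' j : ℕ, Real.exp (-t * (((j + 1 : ℕ) : ℝ) * Real.pi) ^ 2) *
          (∫ x in (0 : ℝ)..1, sineMode (j + 1) x) ^ 2| ≤
      200 * κ ^ 2 * ∑' j : ℕ, Real.exp (-t * (((j + 1 : ℕ) : ℝ) * Real.pi) ^ 2) := by
  rw [heatContent, ← (summable_heatContentTerm hn hκ hκ' ht).tsum_sub
    (summable_exp_mul_integral_sq ht), ← tsum_mul_left, ← Real.norm_eq_abs]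
  refine tsum_of_norm_bounded ((summable_exp_neg_mul_sq ht).mul_left (200 * κ ^ 2)).hasSum
    fun j => ?_
  exact abs_heatContentTerm_sub_le hn hκ hκ' (Nat.le_add_left 1 j) t

theorem eventually_abs_exp_neg_sub_one_le : ∀ᶠ s in 𝓝 (0 : ℝ), |Real.exp (-s) - 1| ≤ 1 / 2 :=
  ((by fun_prop : Continuous fun s : ℝ => |Real.exp (-s) - 1|).tendsto 0).eventually_le_const
    (by norm_num)

theorem hasDerivAt_heatContent_explicitFlow {n : ℕ} (hn : 1 ≤ n) {t : ℝ} (ht : 0 < t) :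
    HasDerivAt (fun s => heatContent (explicitFlow hn s) t) 0 0 := by
  have hκ : HasDerivAt (fun s => (Real.exp (-s) - 1) ^ 2) 0 0 := by
    simpa using (((hasDerivAt_neg (0 : ℝ)).exp).sub_const 1).fun_pow 2
  -- At s = 0 the quadratic bound is zero, which identifies the heat content of the zero potential
  -- with the reference series.
  have h0 := abs_heatContent_sub_le hn (neg_one_lt_exp_neg_sub_one 0) (by simp) ht
  have e0 : heatContent (explicitFlow hn 0) t =
      ∑' j : ℕ, Real.exp (-t * (((j + 1 : ℕ) : ℝ) * Real.pi) ^ 2) *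
          (∫ x in (0 : ℝ)..1, sineMode (j + 1) x) ^ 2 := by
    simp only [neg_zero, Real.exp_zero, sub_self, ne_eq, OfNat.ofNat_ne_zero, not_false_eq_true,
      zero_pow, mul_zero, zero_mul] at h0
    simp only [explicitFlow, neg_zero, Real.exp_zero, sub_self]
    exact sub_eq_zero.1 (abs_nonpos_iff.1 h0)
  rw [hasDerivAt_iff_isLittleO] at hκ ⊢
  simp only [smul_zero, sub_zero, neg_zero, Real.exp_zero, sub_self, ne_eq, OfNat.ofNat_ne_zero,
    not_false_eq_true, zero_pow] at hκ ⊢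
  refine Asymptotics.IsBigO.trans_isLittleO (Asymptotics.IsBigO.of_bound
    (200 * ∑' j : ℕ, Real.exp (-t * (((j + 1 : ℕ) : ℝ) * Real.pi) ^ 2)) ?_) hκ
  filter_upwards [eventually_abs_exp_neg_sub_one_le] with s hs
  rw [e0, Real.norm_eq_abs, Real.norm_eq_abs, abs_of_nonneg (sq_nonneg (Real.exp (-s) - 1)),
    mul_right_comm]
  exact abs_heatContent_sub_le hn (neg_one_lt_exp_neg_sub_one s) hs ht

end

theorem corollary4 (n : ℕ) (hn : 1 ≤ n) :
    (∃ γ : ℝ → UnitL2, IsFlowLine n γ) ∧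
    (∀ γ : ℝ → UnitL2, IsFlowLine n γ → ∀ t : ℝ, 0 < t →
      (∀ᶠ s in 𝓝 (0 : ℝ), Summable (fun j : ℕ => heatContentTerm (γ s) t (j + 1))) ∧
      HasDerivAt (fun s : ℝ => heatContent (γ s) t) 0 0) ∧
    vectorField n 0 ≠ 0 ∧
    (∀ t : ℝ, 0 < t → ∀ D : UnitL2 →L[ℝ] ℝ,
      HasFDerivAt (fun q : UnitL2 => heatContent q t) D 0 → D (vectorField n 0) = 0) := by
  have hflow := isFlowLine_explicitFlow hn
  refine ⟨⟨_, hflow⟩, fun γ hγ t ht => ?_, vectorField_zero_ne_zero hn, fun t ht D hD => ?_⟩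
  -- Both claims depend only on the germ of the curve at 0, so local uniqueness reduces them to the
  -- explicit flow.
  · have heq := hγ.eventuallyEq hn hflow
    constructor
    · filter_upwards [heq, eventually_abs_exp_neg_sub_one_le] with s hs hκ
      rw [hs]
      exact summable_heatContentTerm hn (neg_one_lt_exp_neg_sub_one s) hκ ht
    · refine (hasDerivAt_heatContent_explicitFlow hn ht).congr_of_eventuallyEq ?_
      filter_upwards [heq] with s hs
      rw [hs]
  -- By the chain rule along the explicit flow, D(X_n(0)) is the derivative at 0 already shown to
  -- vanish.
  · have hd := hflow.2 0
    rw [hflow.1] at hd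
    have hD' : HasFDerivAt (fun q : UnitL2 => heatContent q t) D (explicitFlow hn 0) := by
      rwa [hflow.1]
    exact (hD'.comp_hasDerivAt (0 : ℝ) hd).unique (hasDerivAt_heatContent_explicitFlow hn ht)
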